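/- Let $R$ be a Prüfer domain of finite character with quotient field $K$: every nonzero finitely generated ideal of $R$ is invertible, and every nonzero ideal of $R$ is contained in only finitely many maximal ideals. For a domain $T$ with quotient field $K$, let $S(T)$ be the commutative semigroup of nonzero fractional ideals of $T$ under multiplication, modulo nonzero principal fractional ideals; write $\overline{I}$ for the class of $I$. For an idempotent $e$ of a commutative semigroup $S$ put $G_e=\{ae \mid a\in S,\ abe=e \text{ for some } b\in S\}$, the largest subgroup of $S$ with identity $e$. An overring $D$ of $R$ (i.e. $R\subseteq D\subseteq K$) is called fractional if it is a fractional ideal of $R$. $\operatorname{Cl}(D)$ denotes the group of invertible fractional ideals of $D$ modulo the nonzero principal ones. **(A)** Let $J$ be a nonzero fractional ideal of $R$. Then $\overline{J}$ is an idempotent of $S(R)$ if and only if there is a nonzero idempotent fractional ideal $L$ of $R$ (that is, $L^2=L$) with $\overline{J}=\overline{L}$ that is the only idempotent fractional ideal in the class $\overline{J}$ and satisfies one of the following: 1. $L=D$ for some fractional overring $D$ of $R$; or 2. $L=P_1P_2\cdots P_nD$, where $n\ge 1$, $D$ is a fractional overring of $R$, and $P_1,\dots,P_n$ are pairwise distinct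 nonzero idempotent prime ideals of $R$ such that each $P_iD$ is a maximal ideal of $D$. **(B)** Let $L$ be an idempotent fractional ideal of $R$, and let $L=P_1P_2\cdots P_nD$ be any representation as in (2). Then there is an exact sequence of groups $$0\longrightarrow \operatorname{Cl}(D)\stackrel{\phi}{\longrightarrow} G_{\overline{L}}\stackrel{\psi}{\longrightarrow}\prod_{i=1}^{n}G_{\overline{P_iR_{P_i}}}\longrightarrow 0,$$ where $G_{\overline{L}}$ is taken in $S(R)$ and $G_{\overline{P_iR_{P_i}}}$ in $S(R_{P_i})$, and the homomorphisms are the natural ones: $\phi([A])=\overline{AL}$ for each invertible fractional ideal $A$ of $D$, and $\psi(\overline{X})=(\overline{XR_{P_i}})_{1\le i\le n}$ for each nonzero fractional ideal $X$ of $R$ with $\overline{X}\in G_{\overline{L}}$. -/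

import Mathlib

open scoped nonZeroDivisors

noncomputable section

/-! ### Prüfer domains of finite character -/

/-- A domain `R` with quotient field `K` is a Prüfer domain if every nonzero finitely generated
ideal of `R` is invertible (as a fractional ideal). -/
def IsPruferDomain (R K : Type*) [CommRing R] [IsDomain R] [Field K] [Algebra R K]
    [IsFractionRing R K] : Prop :=
  ∀ I : Ideal R, I ≠ ⊥ → I.FG → IsUnit (I : FractionalIdeal R⁰ K)

/-- `R` is of finite character if every nonzero ideal is contained in only finitely many maximal
ideals. -/
def HasFiniteCharacter (R : Type*) [CommRing R] : Prop :=
  ∀ I : Ideal R, I ≠ ⊥ → {M : Ideal R | M.IsMaximal ∧ I ≤ M}.Finite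

/-! ### Constituent groups of a commutative semigroup -/

section Constituent

variable {S : Type*} [CommMonoid S]

/-- For an idempotent `e` of `S`, the group `G_e = {a e | a b e = e for some b}`. -/
def ConstituentGroup {e : S} (_he : IsIdempotentElem e) : Type _ :=
  {x : S // ∃ a b : S, x = a * e ∧ a * b * e = e}

namespace ConstituentGroup

variable {e : S} {he : IsIdempotentElem e}

instance : CoeOut (ConstituentGroup he) S := ⟨Subtype.val⟩

@[ext]
theorem ext {x y : ConstituentGroup he} (h : (x : S) = y) : x = y := Subtype.ext h

theorem exists_inv (x : ConstituentGroup he) : ∃ y : ConstituentGroup he, (y : S) * x = e := by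
  obtain ⟨x, a, b, rfl, h⟩ := x
  refine ⟨⟨b * e, b, a, rfl, by rw [mul_comm b a, h]⟩, ?_⟩
  change b * e * (a * e) = e
  rw [mul_mul_mul_comm, he.eq, mul_comm b a, h]

instance : Mul (ConstituentGroup he) where
  mul x y := ⟨(x : S) * y, by
    obtain ⟨x, a, b, rfl, h⟩ := x
    obtain ⟨y, c, d, rfl, h'⟩ := y
    refine ⟨a * c, b * d, ?_, ?_⟩
    · change a * e * (c * e) = _
      rw [mul_mul_mul_comm, he.eq]
    · rw [mul_mul_mul_comm, mul_assoc, h', h]⟩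

instance : One (ConstituentGroup he) where
  one := ⟨e, e, e, he.eq.symm, by rw [he.eq, he.eq]⟩

instance : Inv (ConstituentGroup he) where
  inv x := (exists_inv x).choose

@[simp] theorem coe_mul (x y : ConstituentGroup he) : ((x * y : ConstituentGroup he) : S) = x * y :=
  rfl

@[simp] theorem coe_one : ((1 : ConstituentGroup he) : S) = e := rfl

/-- `G_e` is a group with the multiplication of `S` and unit `e`. -/
instance : CommGroup (ConstituentGroup he) where
  mul_assoc x y z := ext (mul_assoc (x : S) y z)
  one_mul x := ext (by
    obtain ⟨x, a, b, rfl, h⟩ := x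
    change e * (a * e) = a * e
    rw [mul_left_comm, he.eq])
  mul_one x := ext (by
    obtain ⟨x, a, b, rfl, h⟩ := x
    change a * e * e = a * e
    rw [mul_assoc, he.eq])
  inv_mul_cancel x := ext (exists_inv x).choose_spec
  mul_comm x y := ext (mul_comm (x : S) y)

end ConstituentGroup

end Constituent

/-! ### The class semigroup -/

theorem exists_mem_ne_zero {R K : Type*} [CommRing R] [Field K] [Algebra R K]
    {I : FractionalIdeal R⁰ K} (hI : I ≠ 0) : ∃ x ∈ I, x ≠ 0 := by
  by_contra! h
  exact hI (FractionalIdeal.eq_zero_iff.2 h)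

section ClassSemigroup

variable (R K : Type*) [CommRing R] [IsDomain R] [Field K] [Algebra R K] [IsFractionRing R K]

/-- The monoid `F(R)` of nonzero fractional ideals of `R`. -/
def nonzeroFractionalIdeals : Submonoid (FractionalIdeal R⁰ K) where
  carrier := {I | I ≠ 0}
  mul_mem' {I J} hI hJ h := by
    obtain ⟨x, hx, hx0⟩ := exists_mem_ne_zero hI
    obtain ⟨y, hy, hy0⟩ := exists_mem_ne_zero hJ
    have hxy := FractionalIdeal.mul_mem_mul hx hy
    rw [h, FractionalIdeal.mem_zero_iff] at hxy
    exact mul_ne_zero hx0 hy0 hxy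
  one_mem' := one_ne_zero

/-- Two nonzero fractional ideals are identified if they differ by a nonzero principal factor. -/
def principalCon : Con (nonzeroFractionalIdeals R K) where
  r I J := ∃ x : Kˣ, FractionalIdeal.spanSingleton R⁰ (x : K) * (I : FractionalIdeal R⁰ K) = J
  iseqv :=
    { refl := fun I => ⟨1, by simp⟩
      symm := by
        rintro I J ⟨x, hx⟩
        refine ⟨x⁻¹, ?_⟩
        rw [← hx, ← mul_assoc, FractionalIdeal.spanSingleton_mul_spanSingleton]
        simp
      trans := by
        rintro I J L ⟨x, hx⟩ ⟨y, hy⟩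
        refine ⟨y * x, ?_⟩
        rw [← hy, ← hx, ← mul_assoc, FractionalIdeal.spanSingleton_mul_spanSingleton]
        simp }
  mul' := by
    rintro I J L M ⟨x, hx⟩ ⟨y, hy⟩
    refine ⟨x * y, ?_⟩
    rw [Submonoid.coe_mul, Submonoid.coe_mul, ← hx, ← hy, mul_mul_mul_comm,
      FractionalIdeal.spanSingleton_mul_spanSingleton]
    simp

/-- The class semigroup `S(R) = F(R)/P(R)`. -/
abbrev ClassSemigroup : Type _ := (principalCon R K).Quotient

variable {R K}

/-- The class in `S(R)` of a nonzero fractional ideal. -/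
def fracClass : nonzeroFractionalIdeals R K →* ClassSemigroup R K := (principalCon R K).mk'

/-- The extension `I ↦ I T` of nonzero fractional ideals to an overring `T`. -/
def extendFrac (T : Subalgebra R K) (I : nonzeroFractionalIdeals R K) :
    nonzeroFractionalIdeals T K :=
  ⟨FractionalIdeal.extendedHom K T (I : FractionalIdeal R⁰ K),
    fun h => I.2 ((FractionalIdeal.extendedHom_eq_zero_iff K T).1 h)⟩

theorem coe_extendFrac (T : Subalgebra R K) (I : nonzeroFractionalIdeals R K) :
    ((extendFrac T I : FractionalIdeal T⁰ K) : Submodule T K) =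
      Submodule.span T ((I : FractionalIdeal R⁰ K) : Set K) := by
  change ((FractionalIdeal.extended K _ _ : FractionalIdeal T⁰ K) : Submodule T K) = _
  rw [FractionalIdeal.coe_extended_eq_span]
  congr 1
  refine (Set.image_congr fun x _ => ?_).trans (Set.image_id _)
  obtain ⟨a, b, hb, rfl⟩ := IsFractionRing.div_surjective (A := R) x
  rw [map_div₀, IsLocalization.map_eq, IsLocalization.map_eq]
  rfl

/-- An overring `D` of `R` is fractional if it is a fractional ideal of `R`. -/
def IsFractionalOverring (D : Subalgebra R K) : Prop :=
  IsFractional R⁰ (Subalgebra.toSubmodule D)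

/-- A fractional overring, regarded as a fractional ideal of `R`. -/
def overringIdeal (D : Subalgebra R K) (hD : IsFractionalOverring D) : FractionalIdeal R⁰ K :=
  ⟨Subalgebra.toSubmodule D, hD⟩

theorem isFractional_restrictScalars (D : Subalgebra R K) (hD : IsFractionalOverring D)
    (A : FractionalIdeal D⁰ K) :
    IsFractional R⁰ ((A : Submodule D K).restrictScalars R) := by
  obtain ⟨a, ha, h⟩ := hD
  obtain ⟨d, hd, h'⟩ := A.2
  obtain ⟨r, hr⟩ := h (d : K) d.2
  have hd0 : (d : K) ≠ 0 := fun h0 => nonZeroDivisors.ne_zero hd (Subtype.ext h0)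
  have ha0 : algebraMap R K a ≠ 0 := IsFractionRing.to_map_ne_zero_of_mem_nonZeroDivisors ha
  have hr0 : r ≠ 0 := by
    rintro rfl
    rw [map_zero, Algebra.smul_def] at hr
    exact mul_ne_zero ha0 hd0 hr.symm
  refine ⟨a * r, mul_mem ha (mem_nonZeroDivisors_of_ne_zero hr0), fun b hb => ?_⟩
  obtain ⟨c, hc⟩ := h' b hb
  obtain ⟨s, hs⟩ := h (c : K) c.2
  refine ⟨a * s, ?_⟩
  have hc' : (c : K) = d * b := hc
  rw [map_mul, hs, hc', Algebra.smul_def, Algebra.smul_def, map_mul, hr, Algebra.smul_def]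
  ring

/-- A nonzero fractional ideal of a fractional overring `D`, regarded as a fractional ideal
of `R`. -/
def restrictFrac (D : Subalgebra R K) (hD : IsFractionalOverring D)
    (A : nonzeroFractionalIdeals D K) : nonzeroFractionalIdeals R K :=
  ⟨⟨((A : FractionalIdeal D⁰ K) : Submodule D K).restrictScalars R,
      isFractional_restrictScalars D hD A⟩, fun h => A.2 (by
    obtain ⟨A, hA⟩ := A
    obtain ⟨x, hx, hx0⟩ := exists_mem_ne_zero hA
    refine absurd ((FractionalIdeal.mem_zero_iff (S := R⁰)).1 ?_) hx0
    rw [← h]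
    exact hx)⟩

/-- An invertible fractional ideal is nonzero. -/
def ofUnit {T : Subalgebra R K} (A : (FractionalIdeal T⁰ K)ˣ) : nonzeroFractionalIdeals T K :=
  ⟨A, A.ne_zero⟩

/-- The localization `R_P` as a subring of `K`. -/
def localizationAt (K : Type*) [Field K] [Algebra R K] [IsFractionRing R K]
    (P : PrimeSpectrum R) : Subalgebra R K :=
  Localization.subalgebra.ofField K P.asIdeal.primeCompl P.asIdeal.primeCompl_le_nonZeroDivisors

/-- The ideal `P R_P` of `R_P`, for a nonzero prime `P`. -/
def localIdeal (K : Type*) [Field K] [Algebra R K] [IsFractionRing R K]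
    (P : PrimeSpectrum R) (hP : P.asIdeal ≠ ⊥) :
    nonzeroFractionalIdeals (localizationAt K P) K :=
  ⟨((P.asIdeal.map (algebraMap R (localizationAt K P)) : Ideal (localizationAt K P)) :
      FractionalIdeal (localizationAt K P)⁰ K), by
    rw [← FractionalIdeal.extendedHom_coeIdeal_eq_map (K := K)]
    exact fun h => hP (FractionalIdeal.coeIdeal_eq_zero.1
      ((FractionalIdeal.extendedHom_eq_zero_iff K (localizationAt K P)).1 h))⟩

theorem isIdempotentElem_localIdeal (P : PrimeSpectrum R) (hP : P.asIdeal ≠ ⊥)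
    (h : IsIdempotentElem P.asIdeal) : IsIdempotentElem (localIdeal K P hP) := by
  apply Subtype.ext
  change ((P.asIdeal.map (algebraMap R (localizationAt K P)) : Ideal (localizationAt K P)) :
      FractionalIdeal (localizationAt K P)⁰ K) *
    ((P.asIdeal.map (algebraMap R (localizationAt K P)) : Ideal (localizationAt K P)) :
      FractionalIdeal (localizationAt K P)⁰ K) = _
  rw [← FractionalIdeal.coeIdeal_mul, ← Ideal.map_mul, h.eq]
  rfl

/-- `L = P₁ ⋯ Pₙ D` with `n ≥ 1`, `D` a fractional overring of `R`, and the `Pᵢ` pairwise distinct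
nonzero idempotent primes of `R` such that each `Pᵢ D` is a maximal ideal of `D`. -/
structure IsPrimeProduct (D : Subalgebra R K) (hD : IsFractionalOverring D) {n : ℕ}
    (P : Fin n → PrimeSpectrum R) (L : nonzeroFractionalIdeals R K) : Prop where
  pos : 0 < n
  injective : Function.Injective P
  ne_bot : ∀ i, (P i).asIdeal ≠ ⊥
  idempotent : ∀ i, IsIdempotentElem (P i).asIdeal
  maximal : ∀ i, ((P i).asIdeal.map (algebraMap R D)).IsMaximal
  eq : (L : FractionalIdeal R⁰ K) =
    (∏ i, ((P i).asIdeal : FractionalIdeal R⁰ K)) * overringIdeal D hD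

end ClassSemigroup

end

/-!
The Prüfer condition enters through an elementwise splitting property (`HasSplitting`), which passes
to every overring `D` and says that the localizations of `D` at its primes are valuation rings.
Finite character passes to overrings too (`HasFiniteCharacter.subalgebra`), because the contractions
of distinct maximal ideals of `D` lie in no common maximal ideal of `R`. All local computations can
therefore be carried out in `D`, with finitely many maximal ideals at a time.

*Idempotent classes.* If `J² = x J`, then `L = x⁻¹ J` is idempotent, and it is the only idempotent
in its class since `L² = L` and `(x L)² = x L` give `x L = L`. An idempotent `L` is an ideal of its
multiplier ring `D = (L : L)`. If some `q` in a maximal ideal `N` of `D` were missing from `L_N`,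
idempotence would give `L_N ⊆ q L_N`, and finite character would produce `r ∉ N` with
`r q⁻¹ L ⊆ L`, contrary to `(L : L) = D` (`exists_mul_mem_of_isIdempotentElem`). So `L_N` is the
maximal ideal of `D_N` at every `N ⊇ L`, and `L` is the product of those `N`
(`exists_eq_prod_of_isIdempotentElem`). They are extended from their contractions to `R`, which are
again idempotent (`HasSplitting.isIdempotentElem_comap`).

*The exact sequence.* Let `L = P₁ ⋯ Pₙ D`. Localizing shows `(L : L) = D`, so `A L = x L` with `A`
invertible forces `A = x D`; this is injectivity of `φ`. Invertible ideals are locally principal,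
so `ψ φ = 1`. If `X Y = L` and each `X R_{P_i}` is principal over `P_i R_{P_i}`, then `(X : L)` and
`(Y : L)` are inverse to each other and `X = (X : L) L`
(`IsLocallyMaximal.exists_unit_mul_eq`); this is exactness in the middle. For surjectivity, a
fractional ideal `Z` of `R_{P_i}` with `Z Z' = P_i R_{P_i}` is rescaled so that it is the
localization of a fractional ideal of `D` that is trivial at every other maximal ideal
(`exists_mul_eq_of_localization_mul_eq`).
-/

set_option linter.unusedSectionVars false

/-! ### Local arguments with elements -/

/-- The elementwise form of the Prüfer condition on a domain `A` with quotient field `K`: for every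
`x` there is `u` with `u x ∈ A` and `1 - u ∈ x A`. At a prime `N` either `u` or `1 - u` is a unit,
so `A_N` is a valuation ring; unlike the condition on finitely generated ideals, this one visibly
passes to overrings. It is stated without inverses, so that `x = 0` needs no exception. -/
def HasSplitting (A K : Type*) [CommRing A] [Field K] [Algebra A K] : Prop :=
  ∀ x : K, ∃ u r t : A, u • x = algebraMap A K r ∧ algebraMap A K (1 - u) = t • x

/-- Membership in a submodule is local. Throughout, localizations at `N` are handled by elements:
`x` lies in the localization of `X` at `N` if and only if `s x ∈ X` for some `s ∉ N`. -/
theorem mem_of_forall_isMaximal {A W : Type*} [CommRing A] [AddCommGroup W] [Module A W]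
    (X : Submodule A W) {x : W}
    (h : ∀ N : Ideal A, N.IsMaximal → ∃ s ∉ N, s • x ∈ X) : x ∈ X := by
  by_contra hx
  have hne : X.comap (LinearMap.toSpanSingleton A W x) ≠ ⊤ := fun htop => hx (by
    have : (1 : A) ∈ X.comap (LinearMap.toSpanSingleton A W x) := htop ▸ Submodule.mem_top
    simpa using this)
  obtain ⟨N, hN, hle⟩ := Ideal.exists_le_maximal _ hne
  obtain ⟨s, hs, hsx⟩ := h N hN
  exact hs (hle hsx)

/-- Finitely many conditions that are stable under multiples and each met outside the prime `M` are
met simultaneously outside `M`. Combined with finite character, this replaces the choice of a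
denominator for each maximal ideal by that of one denominator. -/
theorem exists_notMem_forall_mem {A ι : Type*} [CommRing A] {F : Set ι} (hF : F.Finite)
    (M : Ideal A) [M.IsPrime] {p : ι → A → Prop} (hp : ∀ i a b, p i a → p i (b * a))
    (h : ∀ i ∈ F, ∃ r ∉ M, p i r) : ∃ r ∉ M, ∀ i ∈ F, p i r := by
  induction F, hF using Set.Finite.induction_on with
  | empty => exact ⟨1, M.one_notMem, by simp⟩
  | @insert i F hi hF ih =>
    obtain ⟨r, hr, hrF⟩ := ih fun j hj => h j (Set.mem_insert_of_mem _ hj)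
    obtain ⟨s, hs, hsi⟩ := h i (Set.mem_insert _ _)
    refine ⟨r * s, fun hm => (Ideal.IsPrime.mem_or_mem ‹_› hm).elim hr hs, ?_⟩
    rintro j (rfl | hj)
    · exact hp _ _ _ hsi
    · exact mul_comm r s ▸ hp _ _ _ (hrF j hj)

theorem exists_mem_notMem_of_isMaximal {A : Type*} [CommRing A] {M N : Ideal A}
    (hM : M.IsMaximal) (hN : N.IsMaximal) (h : N ≠ M) : ∃ m ∈ N, m ∉ M := by
  by_contra! hle
  exact h (hN.eq_of_le hM.ne_top hle)

/-- `Λ` agrees locally with `N` at every maximal ideal `N` that contains it: `Λ_N = N_N`, witnessed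
by a single denominator `q`. -/
def IsLocallyMaximal {A : Type*} [CommRing A] (Λ : Ideal A) : Prop :=
  ∀ N : Ideal A, N.IsMaximal → Λ ≤ N → ∃ q ∉ N, ∀ m ∈ N, q * m ∈ Λ

theorem IsLocallyMaximal.prod {A : Type*} [CommRing A] {n : ℕ} {M : Fin n → Ideal A}
    (hM : ∀ i, (M i).IsMaximal) (hinj : Function.Injective M) :
    IsLocallyMaximal (∏ i, M i) := by
  intro N hN hle
  obtain ⟨i, -, hi⟩ := (Ideal.IsPrime.prod_le hN.isPrime).1 hle
  obtain rfl := (hM i).eq_of_le hN.ne_top hi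
  have hnot : ¬ (∏ j ∈ Finset.univ.erase i, M j) ≤ M i := fun h => by
    obtain ⟨j, hj, hji⟩ := (Ideal.IsPrime.prod_le hN.isPrime).1 h
    exact (Finset.mem_erase.1 hj).1 (hinj ((hM j).eq_of_le hN.ne_top hji))
  obtain ⟨q, hq, hqi⟩ := Set.not_subset.1 hnot
  refine ⟨q, hqi, fun m hm => ?_⟩
  rw [← Finset.mul_prod_erase Finset.univ M (Finset.mem_univ i), mul_comm q]
  exact Ideal.mul_mem_mul hm hq

section

variable {A K : Type*} [CommRing A] [Field K] [Algebra A K]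

theorem HasFiniteCharacter.finite_setOf_mem {A : Type*} [CommRing A] (hA : HasFiniteCharacter A)
    {c : A} (hc : c ≠ 0) : {N : Ideal A | N.IsMaximal ∧ c ∈ N}.Finite := by
  refine (hA (Ideal.span {c}) (by simpa using hc)).subset fun N hN => ⟨hN.1, ?_⟩
  simpa [Ideal.span_singleton_le_iff_mem] using hN.2

/-- The localization at a prime is a valuation ring: one of `x`, `y` divides the other in it. -/
theorem HasSplitting.compare (hA : HasSplitting A K) (N : Ideal A) [N.IsPrime] (x y : K) :
    ∃ s ∉ N, ∃ d : A, s • x = d • y ∨ s • y = d • x := by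
  rcases eq_or_ne y 0 with rfl | hy
  · exact ⟨1, N.one_notMem, 0, Or.inr (by simp)⟩
  obtain ⟨u, r, t, hu, ht⟩ := hA (x / y)
  have h1 : u • x = r • y := by
    simp only [Algebra.smul_def] at *
    field_simp at hu
    linear_combination hu
  have h2 : (1 - u) • y = t • x := by
    simp only [Algebra.smul_def] at *
    field_simp at ht
    linear_combination ht
  by_cases h : u ∈ N
  · exact ⟨1 - u, fun h' => N.one_notMem (by simpa using N.add_mem h h'), t, Or.inr h2⟩
  · exact ⟨u, h, r, Or.inl h1⟩

variable [IsFractionRing A K]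

theorem HasSplitting.compare' (hA : HasSplitting A K) (N : Ideal A) [N.IsPrime] (x y : A) :
    ∃ s ∉ N, ∃ d : A, s * x = d * y ∨ s * y = d * x := by
  obtain ⟨s, hs, d, h⟩ := hA.compare N (algebraMap A K x) (algebraMap A K y)
  refine ⟨s, hs, d, ?_⟩
  simpa only [Algebra.smul_def, ← map_mul, (IsFractionRing.injective A K).eq_iff] using h

/-- `(Λ : Λ) = A` for a locally maximal ideal `Λ`, because `(N_N : N_N) = A_N` in each valuation
ring `A_N`. -/
theorem IsLocallyMaximal.mem_range_of_mul_mem (hA : HasSplitting A K) {Λ : Ideal A}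
    (hΛ : IsLocallyMaximal Λ) {x : K}
    (h : ∀ l ∈ Λ, ∃ l' ∈ Λ, l • x = algebraMap A K l') : ∃ d, algebraMap A K d = x := by
  suffices x ∈ Subalgebra.toSubmodule (⊥ : Subalgebra A K) from Algebra.mem_bot.1 this
  have hmem (a : A) : algebraMap A K a ∈ Subalgebra.toSubmodule (⊥ : Subalgebra A K) :=
    Algebra.mem_bot.2 ⟨a, rfl⟩
  refine mem_of_forall_isMaximal _ fun N hN => ?_
  by_cases hle : Λ ≤ N
  · obtain ⟨q, hq, hqΛ⟩ := hΛ N hN hle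
    obtain ⟨s, hs, d, hsd | hsd⟩ := hA.compare N x 1
    · exact ⟨s, hs, by rw [hsd, ← Algebra.algebraMap_eq_smul_one]; exact hmem d⟩
    · by_cases hd : d ∈ N
      · exfalso
        obtain ⟨l, hl, hl'⟩ := h _ (hqΛ d hd)
        rw [mul_smul, ← hsd, smul_smul, ← Algebra.algebraMap_eq_smul_one,
          (IsFractionRing.injective A K).eq_iff] at hl'
        exact (hN.isPrime.mem_or_mem (hl' ▸ hle hl)).elim hq hs
      · exact ⟨d, hd, by rw [← hsd, ← Algebra.algebraMap_eq_smul_one]; exact hmem s⟩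
  · obtain ⟨l, hl, hlN⟩ := Set.not_subset.1 hle
    obtain ⟨l', -, h'⟩ := h l hl
    exact ⟨l, hlN, h' ▸ hmem l'⟩

variable [IsDomain A]

/-- If the localization of `X` at `M` contains that of `M`, then some multiple `r M` with `r ∉ M`
lies in `X`. At a maximal ideal `N ≠ M`, elements `m ∈ N \ M` and `n ∈ M \ N` satisfy
`m ∈ n A_N`, and this puts an element outside `M` into the localization of `X` at `N`; only the
finitely many `N` that contain a fixed nonzero element of `X` impose a condition. -/
theorem exists_smul_mem_of_le_local (hA : HasSplitting A K) (hfc : HasFiniteCharacter A)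
    {M : Ideal A} (hM : M.IsMaximal) (hM0 : M ≠ ⊥) (X : Submodule A K)
    (h : ∀ m ∈ M, ∃ s ∉ M, s • algebraMap A K m ∈ X) :
    ∃ r ∉ M, ∀ m ∈ M, r • algebraMap A K m ∈ X := by
  have := hM.isPrime
  simp only [Algebra.smul_def, ← map_mul] at h ⊢
  have hX (a b : A) (hb : algebraMap A K b ∈ X) : algebraMap A K (a * b) ∈ X := by
    rw [map_mul, ← Algebra.smul_def]
    exact X.smul_mem a hb
  obtain ⟨m₀, hm₀, hm₀0⟩ := Submodule.exists_mem_ne_zero_of_ne_bot hM0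
  obtain ⟨s₀, hs₀, hc⟩ := h m₀ hm₀
  have hc0 : s₀ * m₀ ≠ 0 := mul_ne_zero (fun h => hs₀ (h ▸ M.zero_mem)) hm₀0
  set c := s₀ * m₀
  obtain ⟨r, hr, hrF⟩ := exists_notMem_forall_mem
    ((hfc.finite_setOf_mem hc0).subset (t := {N : Ideal A | (N.IsMaximal ∧ c ∈ N) ∧ N ≠ M})
      fun N hN => hN.1) M (p := fun N r => ∃ t ∉ N, algebraMap A K (t * r) ∈ X)
    (fun N a b ⟨t, ht, hta⟩ => ⟨t, ht, mul_left_comm b t a ▸ hX b _ hta⟩) (by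
      rintro N ⟨⟨hN, -⟩, hNM⟩
      have := hN.isPrime
      obtain ⟨m, hmN, hmM⟩ := exists_mem_notMem_of_isMaximal hM hN hNM
      obtain ⟨n, hnM, hnN⟩ := exists_mem_notMem_of_isMaximal hN hM hNM.symm
      obtain ⟨s, hs, hsn⟩ := h n hnM
      obtain ⟨t, ht, d, htd | htd⟩ := hA.compare' N n m
      · exact absurd (htd ▸ N.mul_mem_left d hmN)
          fun h => (hN.isPrime.mem_or_mem h).elim ht hnN
      · refine ⟨s * m, fun h => (hM.isPrime.mem_or_mem h).elim hs hmM, t, ht, ?_⟩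
        rw [mul_left_comm, htd, mul_left_comm]
        exact hX _ _ hsn)
  refine ⟨r, hr, fun m hm => mem_of_forall_isMaximal X fun N hN => ?_⟩
  simp only [Algebra.smul_def, ← map_mul]
  rcases eq_or_ne N M with rfl | hNM
  · obtain ⟨s, hs, hsm⟩ := h m hm
    exact ⟨s, hs, mul_left_comm r s m ▸ hX r _ hsm⟩
  by_cases hcN : c ∈ N
  · obtain ⟨t, ht, htr⟩ := hrF N ⟨⟨hN, hcN⟩, hNM⟩
    refine ⟨t, ht, ?_⟩
    rw [← mul_assoc, mul_comm]
    exact hX _ _ htr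
  · refine ⟨c, hcN, ?_⟩
    rw [mul_comm]
    exact hX _ _ hc

end

section

variable {A K : Type*} [CommRing A] [Field K] [Algebra A K] [IsFractionRing A K]

/-! ### Idempotent ideals with trivial multiplier ring -/

/-- If `q ∉ I_N`, then `I_N ⊆ q A_N`, and so `I_N = I_N I_N ⊆ q I_N` by idempotence. -/
theorem exists_mul_eq_mul_of_isIdempotentElem (hA : HasSplitting A K) {I : Ideal A}
    (hI : IsIdempotentElem I) {N : Ideal A} [N.IsPrime] {q : A}
    (hq : ∀ s ∉ N, s * q ∉ I) {l : A} (hl : l ∈ I) :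
    ∃ s ∉ N, ∃ l' ∈ I, s * l = q * l' := by
  rw [← hI.eq] at hl
  induction hl using Submodule.mul_induction_on' with
  | mem_mul_mem a ha b hb =>
    obtain ⟨s, hs, d, h | h⟩ := hA.compare' N a q
    · exact ⟨s, hs, d * b, I.mul_mem_left d hb, by linear_combination b * h⟩
    · exact absurd (h ▸ I.mul_mem_left d ha) (hq s hs)
  | add x _ y _ hx hy =>
    obtain ⟨s, hs, l, hl, h⟩ := hx
    obtain ⟨t, ht, m, hm, h'⟩ := hy
    exact ⟨s * t, fun h => (Ideal.IsPrime.mem_or_mem ‹_› h).elim hs ht, t * l + s * m,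
      I.add_mem (I.mul_mem_left t hl) (I.mul_mem_left s hm), by
        linear_combination t * h + s * h'⟩

variable [IsDomain A]

/-- If `q ∉ I_N`, then at any other maximal ideal `N'` some `r ∉ N` satisfies `r I ⊆ q I_{N'}`.
Otherwise `q ∈ s I_{N'}` for every `s ∉ N`: then `q` is divisible at `N'` by everything outside
`N`, which is incompatible with `I_N ⊆ q I_N`. -/
theorem exists_forall_mul_eq_mul_of_ne (hA : HasSplitting A K) {I : Ideal A}
    (hI : IsIdempotentElem I) {N N' : Ideal A} (hN : N.IsMaximal) (hN' : N'.IsMaximal)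
    (hne : N' ≠ N) {q : A} (hq : ∀ s ∉ N, s * q ∉ I) :
    ∃ r ∉ N, ∀ l ∈ I, ∃ t ∉ N', ∃ l' ∈ I, t * (r * l) = q * l' := by
  have := hN.isPrime
  have := hN'.isPrime
  have hq0 : q ≠ 0 := by
    rintro rfl
    exact hq 1 N.one_notMem (by simp)
  by_contra! H
  -- `q ∈ s I_{N'}` for every `s ∉ N`, since otherwise `s I_{N'} ⊆ q A_{N'}` and idempotence
  -- makes `s` the required element.
  have key : ∀ s ∉ N, ∃ t ∉ N', ∃ l' ∈ I, t * q = s * l' := by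
    intro s hs
    by_contra! H'
    obtain ⟨l, hl, hbad⟩ := H s hs
    suffices ∃ t ∉ N', ∃ l' ∈ I, t * (s * l) = q * l' by
      obtain ⟨t, ht, l', hl', h⟩ := this
      exact hbad t ht l' hl' h
    clear hbad
    rw [← hI.eq] at hl
    induction hl using Submodule.mul_induction_on' with
    | mem_mul_mem a ha b hb =>
      obtain ⟨t, ht, d, h | h⟩ := hA.compare' N' (s * a) q
      · exact ⟨t, ht, d * b, I.mul_mem_left d hb, by linear_combination b * h⟩
      · exact absurd (by linear_combination h) (H' t ht (d * a) (I.mul_mem_left d ha))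
    | add x _ y _ hx hy =>
      obtain ⟨t, ht, l, hl, h⟩ := hx
      obtain ⟨t', ht', m, hm, h'⟩ := hy
      exact ⟨t * t', fun h => (hN'.isPrime.mem_or_mem h).elim ht ht', t' * l + t * m,
        I.add_mem (I.mul_mem_left t' hl) (I.mul_mem_left t hm), by
          linear_combination t' * h + t * h'⟩
  obtain ⟨t, ht, l₀, hl₀, h₀⟩ := key 1 N.one_notMem
  obtain ⟨s, hs, l₁, hl₁, h₁⟩ := exists_mul_eq_mul_of_isIdempotentElem hA hI hq hl₀
  obtain ⟨s₁, hs₁, l₂, hl₂, h₂⟩ := exists_mul_eq_mul_of_isIdempotentElem hA hI hq hl₁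
  obtain ⟨y, hy, hyN⟩ := exists_mem_notMem_of_isMaximal hN hN' hne
  have hss : s₁ * s ∉ N := fun h => (hN.isPrime.mem_or_mem h).elim hs₁ hs
  have hss0 : s₁ * s ≠ 0 := fun h => hss (h ▸ N.zero_mem)
  -- The extra factor `y ∈ N' \ N` forces `t' * t` into `N'` below.
  obtain ⟨t', ht', l₃, -, h₃⟩ := key (s₁ * s * y)
    fun h => (hN.isPrime.mem_or_mem h).elim hss hyN
  have e₁ : s * t = l₁ := mul_left_cancel₀ hq0 (by linear_combination s * h₀ + h₁)
  have e₂ : t' * t = y * l₃ * l₂ := mul_left_cancel₀ hss0 (by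
    linear_combination t' * s₁ * e₁ + t' * h₂ + l₂ * h₃)
  refine (hN'.isPrime.mem_or_mem (e₂ ▸ ?_ : t' * t ∈ N')).elim ht' ht
  rw [mul_assoc]
  exact N'.mul_mem_right _ hy

/-- An idempotent ideal `I` with `(I : I) = A` satisfies `N ⊆ I_N` at every maximal ideal `N`. If
`q ∈ N` were not in `I_N`, then `r q⁻¹` with a suitable `r ∉ N` would multiply `I` into itself at
every maximal ideal, without lying in `A`. The hypothesis `(I : I) = A` is stated for fractions
`r / q` by means of elements of `A`. -/
theorem exists_mul_mem_of_isIdempotentElem (hA : HasSplitting A K) (hfc : HasFiniteCharacter A)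
    {I : Ideal A} (hI : IsIdempotentElem I)
    (hcol : ∀ r q : A, q ≠ 0 → (∀ l ∈ I, ∃ l' ∈ I, r * l = q * l') → q ∣ r)
    {N : Ideal A} (hN : N.IsMaximal) {q : A} (hqN : q ∈ N) : ∃ s ∉ N, s * q ∈ I := by
  by_contra! hq
  have := hN.isPrime
  have hq0 : q ≠ 0 := by
    rintro rfl
    exact hq 1 N.one_notMem (by simp)
  obtain ⟨r, hr, hrF⟩ := exists_notMem_forall_mem
    ((hfc.finite_setOf_mem hq0).subset (t := {N' : Ideal A | (N'.IsMaximal ∧ q ∈ N') ∧ N' ≠ N})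
      fun N hN => hN.1) N
    (p := fun N' r => ∀ l ∈ I, ∃ t ∉ N', ∃ l' ∈ I, t * (r * l) = q * l')
    (fun N' a b h l hl => by
      obtain ⟨t, ht, l', hl', h⟩ := h l hl
      exact ⟨t, ht, b * l', I.mul_mem_left b hl', by linear_combination b * h⟩)
    fun N' hN' => exists_forall_mul_eq_mul_of_ne hA hI hN hN'.1.1 hN'.2 hq
  have hdvd : q ∣ r := hcol r q hq0 fun l hl => by
    suffices r * l ∈ Ideal.span {q} * I by
      obtain ⟨l', hl', h⟩ := Ideal.mem_span_singleton_mul.1 this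
      exact ⟨l', hl', h.symm⟩
    refine mem_of_forall_isMaximal _ fun N' hN' => ?_
    simp only [Ideal.mem_span_singleton_mul, smul_eq_mul]
    rcases eq_or_ne N' N with rfl | hne
    · obtain ⟨s, hs, l', hl', h⟩ := exists_mul_eq_mul_of_isIdempotentElem hA hI hq hl
      exact ⟨s, hs, r * l', I.mul_mem_left r hl', by linear_combination -r * h⟩
    by_cases hqN' : q ∈ N'
    · obtain ⟨t, ht, l', hl', h⟩ := hrF N' ⟨⟨hN', hqN'⟩, hne⟩ l hl
      exact ⟨t, ht, l', hl', h.symm⟩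
    · exact ⟨q, hqN', r * l, I.mul_mem_left r hl, rfl⟩
  obtain ⟨d, rfl⟩ := hdvd
  exact hr (N.mul_mem_right d hqN)

/-- An idempotent ideal with trivial multiplier ring is the product of the finitely many maximal
ideals containing it, each of which is idempotent. The case `n = 0` is `I = A`. -/
theorem exists_eq_prod_of_isIdempotentElem (hA : HasSplitting A K) (hfc : HasFiniteCharacter A)
    {I : Ideal A} (hI : IsIdempotentElem I) (hI0 : I ≠ ⊥)
    (hcol : ∀ r q : A, q ≠ 0 → (∀ l ∈ I, ∃ l' ∈ I, r * l = q * l') → q ∣ r) :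
    ∃ (n : ℕ) (N : Fin n → Ideal A), (∀ i, (N i).IsMaximal) ∧ Function.Injective N ∧
      (∀ i, IsIdempotentElem (N i)) ∧ I = ∏ i, N i := by
  have hfin := hfc I hI0
  have hloc (N : Ideal A) (hN : N.IsMaximal) (q : A) (hq : q ∈ N) : ∃ s ∉ N, s * q ∈ I :=
    exists_mul_mem_of_isIdempotentElem hA hfc hI hcol hN hq
  set F := hfin.toFinset with hF
  have hmemF (N : Ideal A) : N ∈ F ↔ N.IsMaximal ∧ I ≤ N := by simp [hF]
  let e := F.equivFin.symm
  refine ⟨F.card, fun i => e i, fun i => ((hmemF _).1 (e i).2).1,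
    Subtype.val_injective.comp e.injective, fun i => ?_, ?_⟩
  · obtain ⟨hN, hle⟩ := (hmemF _).1 (e i).2
    refine le_antisymm Ideal.mul_le_left fun x hx => mem_of_forall_isMaximal _ fun N' hN' => ?_
    rcases eq_or_ne N' (e i : Ideal A) with rfl | hne
    · obtain ⟨s, hs, h⟩ := hloc _ hN' x hx
      exact ⟨s, hs, Ideal.mul_mono hle hle (hI.eq.symm ▸ h)⟩
    · obtain ⟨s, hs, hsN⟩ := exists_mem_notMem_of_isMaximal hN' hN hne.symm
      exact ⟨s, hsN, Ideal.mul_mem_mul hs hx⟩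
  · have hprod : ∏ i, (e i : Ideal A) = ∏ N ∈ F, N := by
      rw [← Finset.prod_coe_sort F fun N => N]
      exact e.prod_comp fun N => (N : Ideal A)
    rw [hprod]
    refine le_antisymm ?_ fun x hx => mem_of_forall_isMaximal I fun N hN => ?_
    · rcases F.eq_empty_or_nonempty with h | h
      · simp [h]
      · calc I = I ^ F.card := (hI.pow_eq (Finset.card_ne_zero.2 h)).symm
          _ = ∏ _N ∈ F, I := by rw [Finset.prod_const]
          _ ≤ ∏ N ∈ F, N := Finset.prod_le_prod' fun N hN => ((hmemF N).1 hN).2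
    · by_cases hle : I ≤ N
      · exact hloc N hN x (Ideal.prod_le_inf.trans (Finset.inf_le ((hmemF N).2 ⟨hN, hle⟩)) hx)
      · obtain ⟨l, hl, hlN⟩ := Set.not_subset.1 hle
        exact ⟨l, hlN, I.mul_mem_right x hl⟩

end

section

variable {A K : Type*} [CommRing A] [Field K] [Algebra A K] [IsFractionRing A K]

/-! ### Lifting from the localizations -/

theorem IsLocallyMaximal.le_one_of_mul_le (hA : HasSplitting A K) {Λ : Ideal A}
    (hΛ : IsLocallyMaximal Λ) {B : FractionalIdeal A⁰ K} (h : B * Λ ≤ Λ) : B ≤ 1 := by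
  intro x hx
  rw [FractionalIdeal.mem_one_iff]
  refine hΛ.mem_range_of_mul_mem hA fun l hl => ?_
  have := h (FractionalIdeal.mul_mem_mul hx (FractionalIdeal.mem_coeIdeal_of_mem A⁰ hl))
  obtain ⟨l', hl', e⟩ := (FractionalIdeal.mem_coeIdeal A⁰).1 this
  exact ⟨l', hl', by rw [e, Algebra.smul_def, mul_comm]⟩

variable [IsDomain A]

/-- If `X` contains `x N` locally at `N ⊇ Λ`, then `(X : Λ)` contains a multiple `r x` with
`r ∉ N`. -/
theorem exists_smul_mem_div (hA : HasSplitting A K) (hfc : HasFiniteCharacter A)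
    {Λ : Ideal A} (hΛ0 : Λ ≠ ⊥) {N : Ideal A} (hN : N.IsMaximal) (hle : Λ ≤ N)
    {X : FractionalIdeal A⁰ K} {x : K}
    (hx : ∀ m ∈ N, ∃ s ∉ N, s • (algebraMap A K m * x) ∈ X) :
    ∃ r ∉ N, r • x ∈ X / (Λ : FractionalIdeal A⁰ K) := by
  have hN0 : N ≠ ⊥ := fun h => hΛ0 (le_bot_iff.1 (h ▸ hle))
  obtain ⟨r, hr, h⟩ := exists_smul_mem_of_le_local hA hfc hN hN0
    ((X : Submodule A K).comap (LinearMap.mulRight A x)) (fun m hm => by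
      obtain ⟨s, hs, h⟩ := hx m hm
      refine ⟨s, hs, ?_⟩
      rwa [Submodule.mem_comap, map_smul, LinearMap.mulRight_apply])
  refine ⟨r, hr, (FractionalIdeal.mem_div_iff_of_ne_zero
    (FractionalIdeal.coeIdeal_ne_zero.2 hΛ0)).2 fun y hy => ?_⟩
  obtain ⟨l, hl, rfl⟩ := (FractionalIdeal.mem_coeIdeal A⁰).1 hy
  have := h l (hle hl)
  rw [Submodule.mem_comap, map_smul, LinearMap.mulRight_apply] at this
  rwa [smul_mul_assoc, mul_comm]

/-- If `X` and `Y` are inverse to each other with respect to the unit `Λ`, and locally `X` is a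
principal multiple of `N` at each maximal ideal `N ⊇ Λ`, then `X = B Λ` for an invertible `B`.
Indeed `B = (X : Λ)` is invertible with inverse `(Y : Λ)`. -/
theorem IsLocallyMaximal.exists_unit_mul_eq (hA : HasSplitting A K) (hfc : HasFiniteCharacter A)
    {Λ : Ideal A} (hΛ : IsLocallyMaximal Λ) (hΛ0 : Λ ≠ ⊥) {X Y : FractionalIdeal A⁰ K}
    (hXY : X * Y = Λ) (hX : X * Λ = X) (hY : Y * Λ = Y)
    (hloc : ∀ N : Ideal A, N.IsMaximal → Λ ≤ N → ∃ x : K, x ≠ 0 ∧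
      (∀ m ∈ N, ∃ s ∉ N, s • (algebraMap A K m * x) ∈ X) ∧
      (∀ m ∈ N, ∃ s ∉ N, s • (algebraMap A K m * x⁻¹) ∈ Y)) :
    ∃ B : (FractionalIdeal A⁰ K)ˣ, (B : FractionalIdeal A⁰ K) * Λ = X := by
  have hΛ0' : (Λ : FractionalIdeal A⁰ K) ≠ 0 := FractionalIdeal.coeIdeal_ne_zero.2 hΛ0
  set Λ' : FractionalIdeal A⁰ K := (Λ : FractionalIdeal A⁰ K)
  have hdiv (Z : FractionalIdeal A⁰ K) : Z / Λ' * Λ' ≤ Z :=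
    FractionalIdeal.mul_le.2 fun i hi j hj =>
      (FractionalIdeal.mem_div_iff_of_ne_zero hΛ0').1 hi j hj
  have hsub (Z : FractionalIdeal A⁰ K) (hZ : Z * Λ' = Z) : Z ≤ Z / Λ' :=
    (FractionalIdeal.le_div_iff_mul_le hΛ0').2 hZ.le
  set B := X / Λ'
  set C := Y / Λ'
  have hΛidem : Λ' * Λ' = Λ' := by
    nth_rewrite 1 [← hXY]
    rw [mul_assoc, hY, hXY]
  have hle : B * C ≤ 1 := hΛ.le_one_of_mul_le hA (by
    calc B * C * Λ' = (B * Λ') * (C * Λ') := by rw [mul_mul_mul_comm, hΛidem]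
      _ ≤ X * Y := mul_le_mul' (hdiv X) (hdiv Y)
      _ = Λ' := hXY)
  have hBC : B * C = 1 := by
    refine le_antisymm hle (FractionalIdeal.one_le.2 ?_)
    refine mem_of_forall_isMaximal ((B * C : FractionalIdeal A⁰ K) : Submodule A K)
      fun N hN => ?_
    by_cases hΛN : Λ ≤ N
    · obtain ⟨x, hx0, hxX, hxY⟩ := hloc N hN hΛN
      obtain ⟨r, hr, h⟩ := exists_smul_mem_div hA hfc hΛ0 hN hΛN hxX
      obtain ⟨t, ht, h'⟩ := exists_smul_mem_div hA hfc hΛ0 hN hΛN hxY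
      refine ⟨r * t, fun h => (hN.isPrime.mem_or_mem h).elim hr ht, ?_⟩
      have := FractionalIdeal.mul_mem_mul h h'
      rwa [smul_mul_smul_comm, mul_inv_cancel₀ hx0] at this
    · obtain ⟨l, hl, hlN⟩ := Set.not_subset.1 hΛN
      refine ⟨l, hlN, ?_⟩
      have h1 : Λ' ≤ B * C := hXY ▸ mul_le_mul' (hsub X hX) (hsub Y hY)
      rw [← Algebra.algebraMap_eq_smul_one]
      exact h1 (FractionalIdeal.mem_coeIdeal_of_mem A⁰ hl)
  refine ⟨Units.mkOfMulEqOne B C hBC, le_antisymm (hdiv X) ?_⟩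
  calc X = B * (C * X) := by rw [← mul_assoc, hBC, one_mul]
    _ = B * ((C * Λ') * X) := by rw [mul_assoc, mul_comm Λ', hX]
    _ ≤ B * (Y * X) := by gcongr; exact hdiv Y
    _ = B * Λ' := by rw [mul_comm Y, hXY]

/-- Let `Z` and `Z'` be `A_M`-submodules of `K` with `Z Z' = M_M`. Up to a scalar `a`, the module
`Z` is the localization at `M` of a fractional ideal `X` of `A` that is trivial at all other maximal
ideals and satisfies `X Y = M` for an ideal `Y`. The scalar is an element of `Z` such that
`Y = a Z' ∩ A` lies in no maximal ideal `N ≠ M`; finite character makes a single such choice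
possible. -/
theorem exists_mul_eq_of_localization_mul_eq (hA : HasSplitting A K) (hfc : HasFiniteCharacter A)
    {M : Ideal A} (hM : M.IsMaximal) (hM0 : M ≠ ⊥) {Z Z' : Submodule A K}
    (hZ : ∀ s ∉ M, ∀ z : K, s • z ∈ Z → z ∈ Z) (hZ' : ∀ s ∉ M, ∀ z : K, s • z ∈ Z' → z ∈ Z')
    (hmul : ∀ z ∈ Z, ∀ z' ∈ Z', ∃ s ∉ M, ∃ m ∈ M, s • (z * z') = algebraMap A K m)
    (hmem : ∀ m ∈ M, algebraMap A K m ∈ Z * Z') :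
    ∃ a : K, a ≠ 0 ∧ ∃ X Y : FractionalIdeal A⁰ K, X * Y = M ∧ 1 ∈ X ∧
      (∀ N : Ideal A, N.IsMaximal → N ≠ M → ∀ x ∈ X, ∃ s ∉ N, ∃ d : A,
        s • x = algebraMap A K d) ∧
      (∀ x ∈ X, a * x ∈ Z) ∧ ∀ z ∈ Z, ∃ s ∉ M, ∃ x ∈ X, a * x = s • z := by
  have := hM.isPrime
  -- As `A_M` is a valuation ring, every element of `Z Z'` is a product.
  have hpure (m : K) (hm : m ∈ Z * Z') : ∃ z ∈ Z, ∃ z' ∈ Z', m = z * z' := by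
    induction hm using Submodule.mul_induction_on' with
    | mem_mul_mem z hz z' hz' => exact ⟨z, hz, z', hz', rfl⟩
    | add x _ y _ hx hy =>
      have aux (z₁ z₂ z₁' z₂' : K) (h₁ : z₁ ∈ Z) (h₁' : z₁' ∈ Z') (h₂' : z₂' ∈ Z')
          (s : A) (hs : s ∉ M) (d : A) (h : s • z₂ = d • z₁) :
          ∃ z ∈ Z, ∃ z' ∈ Z', z₁ * z₁' + z₂ * z₂' = z * z' := by
        have hs0 : algebraMap A K s ≠ 0 := fun h0 => hs (by
          rw [(FaithfulSMul.algebraMap_eq_zero_iff A K).1 h0]; exact M.zero_mem)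
        refine ⟨z₁, h₁, z₁' + (algebraMap A K d / algebraMap A K s) * z₂', Z'.add_mem h₁' ?_, ?_⟩
        · refine hZ' s hs _ ?_
          rw [Algebra.smul_def, ← mul_assoc, mul_div_cancel₀ _ hs0, ← Algebra.smul_def]
          exact Z'.smul_mem d h₂'
        · simp only [Algebra.smul_def] at h
          field_simp
          linear_combination z₂' * h
      obtain ⟨z₁, h₁, z₁', h₁', rfl⟩ := hx
      obtain ⟨z₂, h₂, z₂', h₂', rfl⟩ := hy
      obtain ⟨s, hs, d, h | h⟩ := hA.compare M z₂ z₁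
      · exact aux z₁ z₂ z₁' z₂' h₁ h₁' h₂' s hs d h
      · rw [add_comm]
        exact aux z₂ z₁ z₂' z₁' h₂ h₂' h₁' s hs d h
  obtain ⟨m₀, hm₀, hm₀0⟩ := Submodule.exists_mem_ne_zero_of_ne_bot hM0
  have hm₀0' : algebraMap A K m₀ ≠ 0 := (FaithfulSMul.algebraMap_eq_zero_iff A K).not.2 hm₀0
  obtain ⟨a, haZ, hma, haN⟩ : ∃ a ∈ Z, (∃ z' ∈ Z', algebraMap A K m₀ = a * z') ∧
      ∀ N ∈ {N : Ideal A | N.IsMaximal ∧ m₀ ∈ N}, N ≠ M →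
        ∃ e ∉ N, ∃ z' ∈ Z', algebraMap A K e = a * z' := by
    -- One suitable scalar exists for each `N ∋ m₀`; the one with the largest `a Z'` serves all.
    refine Set.Finite.induction_on_subset {N : Ideal A | N.IsMaximal ∧ m₀ ∈ N}
      (hfc.finite_setOf_mem hm₀0) ?_ ?_
    · obtain ⟨z, hz, h⟩ := hpure _ (hmem m₀ hm₀)
      exact ⟨z, hz, h, by simp⟩
    · rintro N F hN - - ⟨a, haZ, hma, haN⟩
      rcases eq_or_ne N M with rfl | hNM
      · refine ⟨a, haZ, hma, ?_⟩
        rintro N' (rfl | hN') hne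
        · exact absurd rfl hne
        · exact haN N' hN' hne
      obtain ⟨m, hmM, hmN⟩ := exists_mem_notMem_of_isMaximal hN.1 hM hNM.symm
      obtain ⟨b, hb, b', hb', hmb⟩ := hpure _ (hmem m hmM)
      have aux (b c : K) (s : A) (hs : s ∉ M) (d : A) (h : s • c = d • b) (e : A)
          (he : ∃ z' ∈ Z', algebraMap A K e = c * z') : ∃ z' ∈ Z', algebraMap A K e = b * z' := by
        obtain ⟨z', hz', he⟩ := he
        have hs0 : algebraMap A K s ≠ 0 := fun h0 => hs (by
          rw [(FaithfulSMul.algebraMap_eq_zero_iff A K).1 h0]; exact M.zero_mem)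
        refine ⟨(algebraMap A K d / algebraMap A K s) * z', hZ' s hs _ ?_, ?_⟩
        · rw [Algebra.smul_def, ← mul_assoc, mul_div_cancel₀ _ hs0, ← Algebra.smul_def]
          exact Z'.smul_mem d hz'
        · simp only [Algebra.smul_def] at h
          rw [he]
          field_simp
          linear_combination z' * h
      obtain ⟨s, hs, d, h | h⟩ := hA.compare M a b
      · refine ⟨b, hb, aux b a s hs d h _ hma, ?_⟩
        rintro N' (rfl | hN') hne
        · exact ⟨m, hmN, b', hb', hmb⟩
        · obtain ⟨e, he, he'⟩ := haN N' hN' hne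
          exact ⟨e, he, aux b a s hs d h _ he'⟩
      · refine ⟨a, haZ, hma, ?_⟩
        rintro N' (rfl | hN') hne
        · exact ⟨m, hmN, aux a b s hs d h _ ⟨b', hb', hmb⟩⟩
        · exact haN N' hN' hne
  have ha0 : a ≠ 0 := by
    rintro rfl
    obtain ⟨z', -, h⟩ := hma
    exact hm₀0' (by simpa using h)
  have haN' (N : Ideal A) (hN : N.IsMaximal) (hNM : N ≠ M) :
      ∃ e ∉ N, ∃ z' ∈ Z', algebraMap A K e = a * z' := by
    by_cases h : m₀ ∈ N
    · exact haN N ⟨hN, h⟩ hNM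
    · exact ⟨m₀, h, hma⟩
  -- `Y = a Z' ∩ A`
  let Y : Ideal A := (Z'.comap (LinearMap.mulLeft A a⁻¹)).comap (Algebra.linearMap A K)
  have hYmem (e : A) : e ∈ Y ↔ ∃ z' ∈ Z', algebraMap A K e = a * z' := by
    change a⁻¹ * algebraMap A K e ∈ Z' ↔ _
    constructor
    · exact fun h => ⟨_, h, (mul_inv_cancel_left₀ ha0 _).symm⟩
    · rintro ⟨z', hz', h⟩
      rwa [h, inv_mul_cancel_left₀ ha0]
  -- `X = a⁻¹ Z ∩ (M : Y)`
  let X' : Submodule A K :=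
    { carrier := {x | a * x ∈ Z ∧ ∀ y ∈ Y, ∃ m ∈ M, y • x = algebraMap A K m}
      add_mem' := by
        rintro x x' ⟨h, hy⟩ ⟨h', hy'⟩
        refine ⟨mul_add a x x' ▸ Z.add_mem h h', fun y hyY => ?_⟩
        obtain ⟨m, hm, e⟩ := hy y hyY
        obtain ⟨m', hm', e'⟩ := hy' y hyY
        exact ⟨m + m', M.add_mem hm hm', by rw [smul_add, e, e', map_add]⟩
      zero_mem' := ⟨by simp, fun y _ => ⟨0, M.zero_mem, by simp⟩⟩
      smul_mem' := by
        rintro c x ⟨h, hy⟩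
        refine ⟨mul_smul_comm c a x ▸ Z.smul_mem c h, fun y hyY => ?_⟩
        obtain ⟨m, hm, e⟩ := hy y hyY
        exact ⟨c * m, M.mul_mem_left c hm, by
          rw [smul_comm, e, Algebra.smul_def, map_mul]⟩ }
  have hm₀Y : m₀ ∈ Y := (hYmem _).2 hma
  have hX'frac : IsFractional A⁰ X' := ⟨m₀, mem_nonZeroDivisors_of_ne_zero hm₀0, fun x hx => by
    obtain ⟨m, -, h⟩ := hx.2 m₀ hm₀Y
    exact ⟨m, h.symm⟩⟩
  have hYM : Y ≤ M := fun e he => by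
    obtain ⟨z', hz', h⟩ := (hYmem e).1 he
    obtain ⟨s, hs, m, hm, h'⟩ := hmul a haZ z' hz'
    rw [← h, Algebra.smul_def, ← map_mul, (IsFractionRing.injective A K).eq_iff] at h'
    exact (hM.isPrime.mem_or_mem (h' ▸ hm)).resolve_left hs
  have h1X : (1 : K) ∈ X' :=
    ⟨by simpa using haZ, fun y hy => ⟨y, hYM hy, (Algebra.algebraMap_eq_smul_one y).symm⟩⟩
  have hXN (N : Ideal A) (hN : N.IsMaximal) (hNM : N ≠ M) (x : K) (hx : x ∈ X') :
      ∃ s ∉ N, ∃ d : A, s • x = algebraMap A K d := by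
    obtain ⟨e, he, heY⟩ := haN' N hN hNM
    obtain ⟨m, -, h⟩ := hx.2 e ((hYmem e).2 heY)
    exact ⟨e, he, m, h⟩
  have hXM (z : K) (hz : z ∈ Z) : ∃ s ∉ M, ∃ x ∈ X', a * x = s • z := by
    obtain ⟨b, t, ht, hbt⟩ := IsFractionRing.div_surjective (A := A) (a⁻¹ * z)
    have ht0 : t ≠ 0 := nonZeroDivisors.ne_zero ht
    have ht0' : algebraMap A K t ≠ 0 := (FaithfulSMul.algebraMap_eq_zero_iff A K).not.2 ht0
    obtain ⟨s, hs, hsF⟩ := exists_notMem_forall_mem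
      ((hfc.finite_setOf_mem ht0).subset
        (t := {N : Ideal A | (N.IsMaximal ∧ t ∈ N) ∧ N ≠ M})
        fun N hN => hN.1) M
      (p := fun N s => ∃ e ∉ N, ∃ d : A, (e * s) • (a⁻¹ * z) = algebraMap A K d)
      (fun N c c' ⟨e, he, d, h⟩ => ⟨e, he, c' * d, by
        rw [mul_left_comm, mul_smul, h, Algebra.smul_def, map_mul]⟩) (by
        rintro N ⟨⟨hN, -⟩, hNM⟩
        obtain ⟨e, he, z', hz', h⟩ := haN' N hN hNM
        obtain ⟨s, hs, m, hm, h'⟩ := hmul z hz z' hz'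
        refine ⟨s, hs, e, he, m, ?_⟩
        simp only [Algebra.smul_def, map_mul] at h' ⊢
        rw [h, ← h']
        field_simp)
    refine ⟨s, hs, s • (a⁻¹ * z), ⟨?_, fun y hy => ?_⟩, ?_⟩
    · rw [mul_smul_comm, mul_inv_cancel_left₀ ha0]
      exact Z.smul_mem s hz
    · suffices y • s • (a⁻¹ * z) ∈ ((M : FractionalIdeal A⁰ K) : Submodule A K) by
        obtain ⟨m, hm, h⟩ := (FractionalIdeal.mem_coeIdeal A⁰).1 this
        exact ⟨m, hm, h.symm⟩
      refine mem_of_forall_isMaximal _ fun N hN => ?_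
      have hmM (d : A) (hd : d ∈ M) :
          algebraMap A K d ∈ ((M : FractionalIdeal A⁰ K) : Submodule A K) :=
        FractionalIdeal.mem_coeIdeal_of_mem A⁰ hd
      rcases eq_or_ne N M with rfl | hNM
      · obtain ⟨z', hz', h⟩ := (hYmem y).1 hy
        obtain ⟨r, hr, m, hm, h'⟩ := hmul z hz z' hz'
        refine ⟨r, hr, ?_⟩
        convert hmM _ (N.mul_mem_left s hm) using 1
        rw [map_mul, ← h']
        simp only [Algebra.smul_def, h]
        field_simp
      · by_cases htN : t ∈ N
        · obtain ⟨e, he, d, h⟩ := hsF N ⟨⟨hN, htN⟩, hNM⟩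
          refine ⟨e, he, ?_⟩
          convert hmM _ (M.mul_mem_left d (hYM hy)) using 1
          rw [map_mul, ← h]
          simp only [Algebra.smul_def, map_mul]
          ring
        · refine ⟨t, htN, ?_⟩
          convert hmM _ (M.mul_mem_left (s * b) (hYM hy)) using 1
          rw [← hbt]
          simp only [Algebra.smul_def, map_mul]
          field_simp
    · rw [mul_smul_comm, mul_inv_cancel_left₀ ha0]
  refine ⟨a, ha0, ⟨X', hX'frac⟩, (Y : FractionalIdeal A⁰ K), le_antisymm ?_ ?_, h1X, hXN,
    fun x hx => hx.1, hXM⟩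
  · refine FractionalIdeal.mul_le.2 fun x hx y hy => ?_
    obtain ⟨y, hyY, rfl⟩ := (FractionalIdeal.mem_coeIdeal A⁰).1 hy
    obtain ⟨m, hm, h⟩ := hx.2 y hyY
    rw [mul_comm, ← Algebra.smul_def, h]
    exact FractionalIdeal.mem_coeIdeal_of_mem A⁰ hm
  · intro y hy
    obtain ⟨m, hm, rfl⟩ := (FractionalIdeal.mem_coeIdeal A⁰).1 hy
    refine mem_of_forall_isMaximal ((⟨X', hX'frac⟩ * (Y : FractionalIdeal A⁰ K) :
      FractionalIdeal A⁰ K) : Submodule A K) fun N hN => ?_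
    have hmulXY (x : K) (hx : x ∈ X') (y : A) (hy : y ∈ Y) : x * algebraMap A K y ∈
        ((⟨X', hX'frac⟩ * (Y : FractionalIdeal A⁰ K) : FractionalIdeal A⁰ K) : Submodule A K) :=
      FractionalIdeal.mul_mem_mul (I := ⟨X', hX'frac⟩) hx
        (FractionalIdeal.mem_coeIdeal_of_mem A⁰ hy)
    rcases eq_or_ne N M with rfl | hNM
    · obtain ⟨z, hz, z', hz', h⟩ := hpure _ (hmem m hm)
      obtain ⟨s, hs, x, hx, hsx⟩ := hXM z hz
      obtain ⟨r, hr, l, hl, h'⟩ := hmul a haZ z' hz'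
      refine ⟨r * s, fun h => (hN.isPrime.mem_or_mem h).elim hr hs, ?_⟩
      have hlY : l ∈ Y := (hYmem l).2 ⟨r • z', Z'.smul_mem r hz', by rw [← h', mul_smul_comm]⟩
      convert hmulXY x hx l hlY using 1
      rw [h, ← h']
      simp only [Algebra.smul_def, map_mul] at hsx ⊢
      linear_combination -(algebraMap A K r * z') * hsx
    · obtain ⟨e, he, heY⟩ := haN' N hN hNM
      refine ⟨e, he, ?_⟩
      rw [Algebra.smul_def, ← map_mul, ← one_mul (algebraMap A K _)]
      exact hmulXY 1 h1X _ (Y.mul_mem_right m ((hYmem e).2 heY))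

end

section

variable {R K : Type*} [CommRing R] [IsDomain R] [Field K] [Algebra R K] [IsFractionRing R K]

/-! ### Overrings of Prüfer domains of finite character -/

theorem IsPruferDomain.hasSplitting (hR : IsPruferDomain R K) : HasSplitting R K := by
  intro x
  rcases eq_or_ne x 0 with rfl | hx
  · exact ⟨1, 0, 0, by simp, by simp⟩
  obtain ⟨a, b, hb, rfl⟩ := IsFractionRing.div_surjective (A := R) x
  have hb0 : b ≠ 0 := nonZeroDivisors.ne_zero hb
  have hb0' : algebraMap R K b ≠ 0 := (FaithfulSMul.algebraMap_eq_zero_iff R K).not.2 hb0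
  set I : Ideal R := Ideal.span {a, b} with hI
  have haI : a ∈ I := Ideal.subset_span (by simp)
  have hbI : b ∈ I := Ideal.subset_span (by simp)
  obtain ⟨J, hJ⟩ := (hR I (fun h => hb0 (by simpa [h] using hbI))
    (Submodule.fg_span (Set.toFinite _))).exists_right_inv
  have hmem (c : R) (hc : c ∈ I) (q : K) (hq : q ∈ J) : ∃ r, algebraMap R K r = c • q := by
    have := FractionalIdeal.mul_mem_mul (FractionalIdeal.mem_coeIdeal_of_mem R⁰ (P := K) hc) hq
    rw [hJ, FractionalIdeal.mem_one_iff] at this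
    simpa only [Algebra.smul_def] using this
  obtain ⟨p, hp, q, hq, h⟩ : ∃ p ∈ J, ∃ q ∈ J, (1 : K) = a • p + b • q := by
    have h1 : (1 : K) ∈ (I : FractionalIdeal R⁰ K) * J := hJ ▸ FractionalIdeal.one_mem_one R⁰
    refine FractionalIdeal.mul_induction_on h1 ?_ ?_
    · intro i hi j hj
      obtain ⟨c, hc, rfl⟩ := (FractionalIdeal.mem_coeIdeal R⁰).1 hi
      obtain ⟨e, f, rfl⟩ := Ideal.mem_span_pair.1 hc
      refine ⟨e • j, J.1.smul_mem e hj, f • j, J.1.smul_mem f hj, ?_⟩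
      simp only [Algebra.smul_def, map_add, map_mul]
      ring
    · rintro x y ⟨p, hp, q, hq, rfl⟩ ⟨p', hp', q', hq', rfl⟩
      exact ⟨p + p', J.1.add_mem hp hp', q + q', J.1.add_mem hq hq', by
        simp only [smul_add]; ring⟩
  obtain ⟨u, hu⟩ := hmem b hbI q hq
  obtain ⟨r, hr⟩ := hmem a haI q hq
  obtain ⟨t, ht⟩ := hmem b hbI p hp
  refine ⟨u, r, t, ?_, ?_⟩
  · rw [Algebra.smul_def, hu, hr, Algebra.smul_def, Algebra.smul_def]
    field_simp
  · simp only [Algebra.smul_def] at hu ht h ⊢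
    rw [map_sub, map_one, hu, ht, h]
    field_simp
    ring

theorem HasSplitting.subalgebra (hR : HasSplitting R K) (D : Subalgebra R K) :
    HasSplitting D K := fun x => by
  obtain ⟨u, r, t, h, h'⟩ := hR x
  refine ⟨algebraMap R D u, algebraMap R D r, algebraMap R D t, ?_, ?_⟩
  · rw [algebraMap_smul, h, ← IsScalarTower.algebraMap_apply]
  · rw [algebraMap_smul, ← h', ← map_one (algebraMap R D), ← map_sub,
      ← IsScalarTower.algebraMap_apply]

theorem comap_ne_bot {D : Subalgebra R K} {N : Ideal D} (hN : N ≠ ⊥) :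
    N.comap (algebraMap R D) ≠ ⊥ := by
  obtain ⟨c, hc, hc0⟩ := Submodule.exists_mem_ne_zero_of_ne_bot hN
  obtain ⟨a, b, hb, h⟩ := IsFractionRing.div_surjective (A := R) (c : K)
  have hb0 : algebraMap R K b ≠ 0 :=
    (FaithfulSMul.algebraMap_eq_zero_iff R K).not.2 (nonZeroDivisors.ne_zero hb)
  have hac : algebraMap R D a = algebraMap R D b * c := Subtype.ext (by
    change algebraMap R K a = algebraMap R K b * c
    rw [← h]
    field_simp)
  intro hbot
  have ha : a ∈ N.comap (algebraMap R D) := by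
    rw [Ideal.mem_comap, hac]
    exact N.mul_mem_left _ hc
  rw [hbot, Ideal.mem_bot] at ha
  rw [ha, map_zero, zero_div] at h
  exact hc0 (Subtype.ext h.symm)

/-- A maximal ideal of `R` lies over the contraction of at most one maximal ideal of an overring. -/
theorem HasSplitting.eq_of_comap_le (hR : HasSplitting R K) {D : Subalgebra R K} {N₁ N₂ : Ideal D}
    (h₁ : N₁.IsMaximal) (h₂ : N₂.IsMaximal) {M : Ideal R} (hM : M.IsMaximal)
    (hle₁ : N₁.comap (algebraMap R D) ≤ M) (hle₂ : N₂.comap (algebraMap R D) ≤ M) :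
    N₁ = N₂ := by
  by_contra hne
  obtain ⟨x, hx, hx'⟩ := exists_mem_notMem_of_isMaximal h₂ h₁ hne
  obtain ⟨y, hy, hy'⟩ := exists_mem_notMem_of_isMaximal h₁ h₂ (Ne.symm hne)
  have hy0 : (y : K) ≠ 0 := fun h => hy' (by
    rw [show y = 0 from Subtype.ext h]; exact N₁.zero_mem)
  obtain ⟨u, r, t, hu, ht⟩ := hR ((x : K) / y)
  have e₁ : algebraMap R D u * x = algebraMap R D r * y := Subtype.ext (by
    change algebraMap R K u * x = algebraMap R K r * y
    rw [← hu, Algebra.smul_def]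
    field_simp)
  have e₂ : algebraMap R D (1 - u) * y = algebraMap R D t * x := Subtype.ext (by
    change algebraMap R K (1 - u) * y = algebraMap R K t * x
    rw [ht, Algebra.smul_def]
    field_simp)
  by_cases h : u ∈ M
  · have h1u : 1 - u ∉ M := fun h' => hM.ne_top
      ((Ideal.eq_top_iff_one M).2 (by simpa using M.add_mem h h'))
    exact (h₁.isPrime.mem_or_mem (e₂ ▸ N₁.mul_mem_left _ hx)).elim
      (fun h' => h1u (hle₁ h')) hy'
  · exact (h₂.isPrime.mem_or_mem (e₁ ▸ N₂.mul_mem_left _ hy)).elim (fun h' => h (hle₂ h')) hx'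

theorem HasFiniteCharacter.subalgebra (hR : HasSplitting R K) (hfc : HasFiniteCharacter R)
    (D : Subalgebra R K) : HasFiniteCharacter D := by
  intro I hI
  have hex (N : Ideal D) (hN : N.IsMaximal) : ∃ M : Ideal R, M.IsMaximal ∧
      N.comap (algebraMap R D) ≤ M :=
    Ideal.exists_le_maximal _ (Ideal.comap_ne_top _ hN.ne_top)
  choose! f hf hf' using hex
  refine Set.Finite.of_injOn (f := f) (t := {M | M.IsMaximal ∧ I.comap (algebraMap R D) ≤ M})
    (fun N hN => ⟨hf N hN.1, (Ideal.comap_mono hN.2).trans (hf' N hN.1)⟩)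
    (fun N hN N' hN' h => hR.eq_of_comap_le hN.1 hN'.1 (hf N hN.1) (hf' N hN.1)
      (h ▸ hf' N' hN'.1)) (hfc _ (comap_ne_bot hI))

/-- If `P D ≠ D`, then `D ⊆ R_P`. -/
theorem HasSplitting.exists_smul_eq_of_map_ne_top (hR : HasSplitting R K) {D : Subalgebra R K}
    {P : Ideal R} [P.IsPrime] (hP : P.map (algebraMap R D) ≠ ⊤) (d : D) :
    ∃ s ∉ P, ∃ r, s • (d : K) = algebraMap R K r := by
  obtain ⟨u, r, t, hu, ht⟩ := hR d
  by_cases huP : u ∈ P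
  · have h1u : 1 - u ∉ P := fun h' => P.one_notMem (by simpa using P.add_mem huP h')
    refine ⟨t, fun htP => hP ((Ideal.eq_top_iff_one _).2 ?_), 1 - u, ht.symm⟩
    have e : (1 : D) = algebraMap R D u + algebraMap R D t * d := Subtype.ext (by
      change (1 : K) = algebraMap R K u + algebraMap R K t * d
      rw [← Algebra.smul_def, ← ht, map_sub, map_one]
      ring)
    rw [e]
    exact add_mem (Ideal.mem_map_of_mem _ huP)
      (Ideal.mul_mem_right _ _ (Ideal.mem_map_of_mem _ htP))
  · exact ⟨u, huP, r, hu⟩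

theorem HasSplitting.comap_map_eq (hR : HasSplitting R K) {D : Subalgebra R K}
    {P : Ideal R} [P.IsPrime] (hP : P.map (algebraMap R D) ≠ ⊤) :
    (P.map (algebraMap R D)).comap (algebraMap R D) = P := by
  refine le_antisymm (fun r hr => ?_) Ideal.le_comap_map
  have key (x : D) (hx : x ∈ P.map (algebraMap R D)) :
      ∃ s ∉ P, ∃ p ∈ P, s • (x : K) = algebraMap R K p := by
    induction hx using Submodule.span_induction with
    | mem x h =>
      obtain ⟨p, hp, rfl⟩ := h
      exact ⟨1, P.one_notMem, p, hp, by rw [one_smul]; rfl⟩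
    | zero => exact ⟨1, P.one_notMem, 0, P.zero_mem, by simp⟩
    | add x y _ _ hx hy =>
      obtain ⟨s, hs, p, hp, h⟩ := hx
      obtain ⟨s', hs', p', hp', h'⟩ := hy
      refine ⟨s * s', fun h => (Ideal.IsPrime.mem_or_mem ‹_› h).elim hs hs', s' * p + s * p',
        P.add_mem (P.mul_mem_left _ hp) (P.mul_mem_left _ hp'), ?_⟩
      simp only [Algebra.smul_def, map_mul, map_add, ← h, ← h', Subalgebra.coe_add]
      ring
    | smul d x _ hx =>
      obtain ⟨s, hs, p, hp, h⟩ := hx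
      obtain ⟨s', hs', r, h'⟩ := hR.exists_smul_eq_of_map_ne_top hP d
      refine ⟨s * s', fun h => (Ideal.IsPrime.mem_or_mem ‹_› h).elim hs hs', r * p,
        P.mul_mem_left _ hp, ?_⟩
      rw [smul_eq_mul, Subalgebra.coe_mul]
      simp only [Algebra.smul_def, map_mul] at h h' ⊢
      rw [← h, ← h']
      ring
  obtain ⟨s, hs, p, hp, h⟩ := key _ hr
  have e : s * r = p := IsFractionRing.injective R K (by
    rw [map_mul, ← h, Algebra.smul_def]; rfl)
  exact (Ideal.IsPrime.mem_or_mem ‹_› (e ▸ hp)).resolve_left hs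

/-- An element of `D` outside `P D` divides, in `D`, an element of `R` outside `P`; hence localizing
at `P D` and at `P` amounts to the same. -/
theorem HasSplitting.exists_mul_notMem (hR : HasSplitting R K) {D : Subalgebra R K}
    {P : Ideal R} [P.IsPrime] (hP : (P.map (algebraMap R D)).IsMaximal) {s : D}
    (hs : s ∉ P.map (algebraMap R D)) :
    ∃ t : D, ∃ r ∉ P, t * s = algebraMap R D r := by
  obtain ⟨t, ht, r, h⟩ := hR.exists_smul_eq_of_map_ne_top hP.ne_top s
  have e : algebraMap R D t * s = algebraMap R D r := Subtype.ext (by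
    rw [Algebra.smul_def] at h; exact h)
  refine ⟨algebraMap R D t, r, fun hr => ?_, e⟩
  refine (hP.isPrime.mem_or_mem (e ▸ Ideal.mem_map_of_mem _ hr)).elim (fun h' => ht ?_) hs
  rwa [← hR.comap_map_eq hP.ne_top]

theorem HasSplitting.map_comap_eq (hR : HasSplitting R K) {D : Subalgebra R K} (N : Ideal D) :
    (N.comap (algebraMap R D)).map (algebraMap R D) = N := by
  refine le_antisymm Ideal.map_comap_le fun x hx => ?_
  obtain ⟨u, r, t, hu, ht⟩ := hR x
  have e₁ : algebraMap R D u * x = algebraMap R D r := Subtype.ext (by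
    rw [Algebra.smul_def] at hu; exact hu)
  have e₂ : algebraMap R D (1 - u) = algebraMap R D t * x := Subtype.ext (by
    rw [Algebra.smul_def] at ht; exact ht)
  have hr : algebraMap R D r ∈ N := e₁ ▸ N.mul_mem_left _ hx
  have hu' : algebraMap R D (1 - u) ∈ N := e₂ ▸ N.mul_mem_left _ hx
  have e₃ : x = algebraMap R D r + algebraMap R D (1 - u) * x := by
    rw [← e₁, map_sub, map_one]; ring
  rw [e₃]
  exact add_mem (Ideal.mem_map_of_mem (algebraMap R D) (I := N.comap (algebraMap R D)) hr)
    (Ideal.mul_mem_right _ _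
      (Ideal.mem_map_of_mem (algebraMap R D) (I := N.comap (algebraMap R D)) hu'))

/-- The contraction `P` of an idempotent maximal ideal `N = P D` is idempotent. Elements of `N`
become elements of `P` after multiplication by some `1 - u` with `u ∈ P`, so `(1 - u) p ∈ P²` for
each `p ∈ P`, while `u p ∈ P²` anyway. -/
theorem HasSplitting.isIdempotentElem_comap (hR : HasSplitting R K) {D : Subalgebra R K}
    {N : Ideal D} (hN : N.IsMaximal) (h : IsIdempotentElem N) :
    IsIdempotentElem (N.comap (algebraMap R D)) := by
  set P := N.comap (algebraMap R D) with hP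
  have : P.IsPrime := hN.isPrime.comap _
  have hmap : P.map (algebraMap R D) = N := hR.map_comap_eq N
  have hPtop : P.map (algebraMap R D) ≠ ⊤ := hmap.symm ▸ hN.ne_top
  have hdiv (x : D) (hx : x ∈ N) :
      ∃ u ∈ P, ∃ p ∈ P, algebraMap R D (1 - u) * x = algebraMap R D p := by
    rcases eq_or_ne (x : K) 0 with h0 | h0
    · exact ⟨0, P.zero_mem, 0, P.zero_mem, by rw [show x = 0 from Subtype.ext h0]; simp⟩
    obtain ⟨u, r, t, hu, ht⟩ := hR (x : K)⁻¹
    have e₁ : algebraMap R D u = algebraMap R D r * x := Subtype.ext (by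
      change algebraMap R K u = algebraMap R K r * x
      rw [← hu, Algebra.smul_def]
      field_simp)
    have e₂ : algebraMap R D (1 - u) * x = algebraMap R D t := Subtype.ext (by
      change algebraMap R K (1 - u) * x = algebraMap R K t
      rw [ht, Algebra.smul_def]
      field_simp)
    have huP : u ∈ P := by
      rw [hP, Ideal.mem_comap, e₁]
      exact N.mul_mem_left _ hx
    refine ⟨u, huP, t, ?_, e₂⟩
    rw [hP, Ideal.mem_comap, ← e₂]
    exact N.mul_mem_left _ hx
  have key (x : D) (hx : x ∈ N * N) :
      ∃ u ∈ P, ∃ p ∈ P * P, algebraMap R D (1 - u) * x = algebraMap R D p := by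
    induction hx using Submodule.mul_induction_on' with
    | mem_mul_mem x hx y hy =>
      obtain ⟨u, hu, p, hp, e⟩ := hdiv x hx
      obtain ⟨v, hv, q, hq, e'⟩ := hdiv y hy
      refine ⟨u + v - u * v, P.sub_mem (P.add_mem hu hv) (P.mul_mem_right _ hu), p * q,
        Ideal.mul_mem_mul hp hq, ?_⟩
      rw [map_mul, ← e, ← e', show 1 - (u + v - u * v) = (1 - u) * (1 - v) by ring, map_mul]
      ring
    | add x _ y _ hx hy =>
      obtain ⟨u, hu, p, hp, e⟩ := hx
      obtain ⟨v, hv, q, hq, e'⟩ := hy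
      refine ⟨u + v - u * v, P.sub_mem (P.add_mem hu hv) (P.mul_mem_right _ hu),
        (1 - v) * p + (1 - u) * q,
        add_mem (Ideal.mul_mem_left _ _ hp) (Ideal.mul_mem_left _ _ hq), ?_⟩
      rw [map_add, map_mul, map_mul, ← e, ← e',
        show 1 - (u + v - u * v) = (1 - u) * (1 - v) by ring, map_mul]
      ring
  refine le_antisymm Ideal.mul_le_left fun p hp => ?_
  obtain ⟨u, hu, q, hq, e⟩ := key (algebraMap R D p) (h.eq.symm ▸ hp)
  have e' : (1 - u) * p = q := IsFractionRing.injective R K (by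
    rw [map_mul]; exact congrArg Subtype.val e)
  have : p = q + u * p := by rw [← e']; ring
  rw [this]
  exact add_mem hq (Ideal.mul_mem_mul hu hp)

theorem mem_localizationAt {P : PrimeSpectrum R} {x : K} :
    x ∈ localizationAt K P ↔ ∃ s ∉ P.asIdeal, ∃ r, s • x = algebraMap R K r := by
  have : x ∈ localizationAt K P ↔ ∃ (a s : R) (_ : s ∈ P.asIdeal.primeCompl),
      x = algebraMap R K a * (algebraMap R K s)⁻¹ := Iff.rfl
  rw [this]
  constructor
  · rintro ⟨a, s, hs, rfl⟩
    have hs0 : algebraMap R K s ≠ 0 := IsFractionRing.to_map_ne_zero_of_mem_nonZeroDivisors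
      (P.asIdeal.primeCompl_le_nonZeroDivisors hs)
    exact ⟨s, hs, a, by rw [Algebra.smul_def]; field_simp⟩
  · rintro ⟨s, hs, r, h⟩
    have hs0 : algebraMap R K s ≠ 0 := IsFractionRing.to_map_ne_zero_of_mem_nonZeroDivisors
      (P.asIdeal.primeCompl_le_nonZeroDivisors hs)
    refine ⟨r, s, hs, ?_⟩
    rw [← h, Algebra.smul_def]
    field_simp

theorem mem_extendFrac_localizationAt {P : PrimeSpectrum R} {I : nonzeroFractionalIdeals R K}
    {x : K} :
    x ∈ (extendFrac (localizationAt K P) I : FractionalIdeal (localizationAt K P)⁰ K) ↔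
      ∃ s ∉ P.asIdeal, s • x ∈ (I : FractionalIdeal R⁰ K) := by
  rw [← FractionalIdeal.mem_coe, coe_extendFrac]
  constructor
  · intro hx
    induction hx using Submodule.span_induction with
    | mem x h => exact ⟨1, P.asIdeal.one_notMem, by rwa [one_smul]⟩
    | zero =>
      exact ⟨1, P.asIdeal.one_notMem, by
        rw [smul_zero]
        exact (I : FractionalIdeal R⁰ K).1.zero_mem⟩
    | add x y _ _ hx hy =>
      obtain ⟨s, hs, h⟩ := hx
      obtain ⟨t, ht, h'⟩ := hy
      refine ⟨s * t, fun h => (P.isPrime.mem_or_mem h).elim hs ht, ?_⟩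
      rw [smul_add]
      refine (I : FractionalIdeal R⁰ K).1.add_mem ?_ ?_
      · rw [mul_comm, mul_smul]
        exact (I : FractionalIdeal R⁰ K).1.smul_mem t h
      · rw [mul_smul]
        exact (I : FractionalIdeal R⁰ K).1.smul_mem s h'
    | smul d x _ hx =>
      obtain ⟨s, hs, h⟩ := hx
      obtain ⟨t, ht, r, h'⟩ := mem_localizationAt.1 d.2
      refine ⟨t * s, fun h => (P.isPrime.mem_or_mem h).elim ht hs, ?_⟩
      have : (t * s) • d • x = r • s • x := by
        simp only [Algebra.smul_def, map_mul] at h' ⊢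
        rw [← h']
        change _ * (d * x : K) = _
        ring
      rw [this]
      exact (I : FractionalIdeal R⁰ K).1.smul_mem r h
  · rintro ⟨s, hs, h⟩
    have hs0 : algebraMap R K s ≠ 0 := IsFractionRing.to_map_ne_zero_of_mem_nonZeroDivisors
      (P.asIdeal.primeCompl_le_nonZeroDivisors hs)
    have hinv : (algebraMap R K s)⁻¹ ∈ localizationAt K P :=
      mem_localizationAt.2 ⟨s, hs, 1, by rw [Algebra.smul_def, mul_inv_cancel₀ hs0, map_one]⟩
    have := Submodule.smul_mem (Submodule.span (localizationAt K P)
      ((I : FractionalIdeal R⁰ K) : Set K)) ⟨_, hinv⟩ (Submodule.subset_span h)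
    rwa [Algebra.smul_def, Algebra.smul_def, ← mul_assoc,
      show algebraMap (localizationAt K P) K ⟨_, hinv⟩ = (algebraMap R K s)⁻¹ from rfl,
      inv_mul_cancel₀ hs0, one_mul] at this

end

noncomputable section

variable {R K : Type*} [CommRing R] [IsDomain R] [Field K] [Algebra R K] [IsFractionRing R K]

/-! ### Fractional ideals and their classes -/

/-- The nonzero principal fractional ideal generated by `x`. -/
def principalFrac (R : Type*) {K : Type*} [CommRing R] [IsDomain R] [Field K] [Algebra R K]
    [IsFractionRing R K] (x : Kˣ) : nonzeroFractionalIdeals R K :=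
  ⟨FractionalIdeal.spanSingleton R⁰ (x : K),
    FractionalIdeal.spanSingleton_ne_zero_iff.2 x.ne_zero⟩

theorem fracClass_eq_iff {I J : nonzeroFractionalIdeals R K} :
    fracClass I = fracClass J ↔ ∃ x : Kˣ, principalFrac R x * I = J :=
  (principalCon R K).eq.trans
    (exists_congr fun _ => ⟨fun h => Subtype.ext h, fun h => congrArg Subtype.val h⟩)

theorem principalFrac_mul (x y : Kˣ) :
    principalFrac R x * principalFrac R y = principalFrac R (x * y) :=
  Subtype.ext (by simp [principalFrac])

@[simp]
theorem principalFrac_one : principalFrac R (1 : Kˣ) = 1 :=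
  Subtype.ext (by simp [principalFrac])

@[simp]
theorem fracClass_principalFrac_mul (x : Kˣ) (I : nonzeroFractionalIdeals R K) :
    fracClass (principalFrac R x * I) = fracClass I :=
  (fracClass_eq_iff.2 ⟨x, rfl⟩).symm

theorem mem_principalFrac_mul {x : Kˣ} {I : nonzeroFractionalIdeals R K} {y : K} :
    y ∈ ((principalFrac R x * I : nonzeroFractionalIdeals R K) : FractionalIdeal R⁰ K) ↔
      ∃ z ∈ (I : FractionalIdeal R⁰ K), y = x * z :=
  FractionalIdeal.mem_singleton_mul

theorem mul_mem_principalFrac_mul {x : Kˣ} {I : nonzeroFractionalIdeals R K} {y : K} :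
    x * y ∈ ((principalFrac R x * I : nonzeroFractionalIdeals R K) : FractionalIdeal R⁰ K) ↔
      y ∈ (I : FractionalIdeal R⁰ K) := by
  rw [mem_principalFrac_mul]
  constructor
  · rintro ⟨z, hz, h⟩
    rwa [mul_left_cancel₀ x.ne_zero h]
  · exact fun h => ⟨y, h, rfl⟩

/-- A class contains at most one idempotent fractional ideal: if `x I` and `I` are both idempotent,
then `x I = x² I`. -/
theorem principalFrac_mul_eq_of_isIdempotentElem {I : nonzeroFractionalIdeals R K}
    (hI : IsIdempotentElem I) {x : Kˣ} (h : IsIdempotentElem (principalFrac R x * I)) :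
    principalFrac R x * I = I := by
  have e : principalFrac R x * (principalFrac R x * I) = principalFrac R x * I := by
    have := h.eq
    rwa [mul_mul_mul_comm, hI.eq, mul_assoc] at this
  calc principalFrac R x * I
      = principalFrac R x⁻¹ * (principalFrac R x * (principalFrac R x * I)) := by
        rw [← mul_assoc (principalFrac R x⁻¹), principalFrac_mul]; simp
    _ = I := by rw [e, ← mul_assoc, principalFrac_mul]; simp

theorem exists_isIdempotentElem_of_fracClass {J : nonzeroFractionalIdeals R K}
    (h : IsIdempotentElem (fracClass J)) :
    ∃ L : nonzeroFractionalIdeals R K, IsIdempotentElem L ∧ fracClass J = fracClass L := by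
  obtain ⟨x, hx⟩ := fracClass_eq_iff.1 ((fracClass.map_mul J J).trans h.eq)
  refine ⟨principalFrac R x * J, ?_, (fracClass_principalFrac_mul x J).symm⟩
  calc principalFrac R x * J * (principalFrac R x * J)
      = principalFrac R x * (principalFrac R x * (J * J)) := by
        rw [mul_mul_mul_comm, mul_assoc]
    _ = _ := by rw [hx]

/-- Extension to an overring, as a homomorphism. -/
def extendFracHom (T : Subalgebra R K) :
    nonzeroFractionalIdeals R K →* nonzeroFractionalIdeals T K where
  toFun := extendFrac T
  map_one' := Subtype.ext (map_one (FractionalIdeal.extendedHom K T))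
  map_mul' I J := Subtype.ext
    (RingHom.map_mul (FractionalIdeal.extendedHom K T) (I : FractionalIdeal R⁰ K) J)

theorem extendFrac_mul (T : Subalgebra R K) (I J : nonzeroFractionalIdeals R K) :
    extendFrac T (I * J) = extendFrac T I * extendFrac T J :=
  (extendFracHom T).map_mul I J

theorem extendFrac_principalFrac (T : Subalgebra R K) (x : Kˣ) :
    extendFrac T (principalFrac R x) = principalFrac T x := by
  apply Subtype.ext
  apply FractionalIdeal.coeToSubmodule_injective
  beta_reduce
  rw [coe_extendFrac]
  change Submodule.span T
    ((FractionalIdeal.spanSingleton R⁰ (x : K) : FractionalIdeal R⁰ K) : Set K) =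
    ((FractionalIdeal.spanSingleton T⁰ (x : K) : FractionalIdeal T⁰ K) : Submodule T K)
  rw [FractionalIdeal.coe_spanSingleton]
  refine le_antisymm (Submodule.span_le.2 fun y hy => ?_) (Submodule.span_le.2 ?_)
  · obtain ⟨r, rfl⟩ := (FractionalIdeal.mem_spanSingleton R⁰).1 hy
    rw [← algebraMap_smul T r (x : K)]
    exact Submodule.smul_mem _ _ (Submodule.mem_span_singleton_self _)
  · rintro _ rfl
    exact Submodule.subset_span (FractionalIdeal.mem_spanSingleton_self R⁰ _)

/-- The map of class semigroups induced by extension to an overring. -/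
def extendClass (T : Subalgebra R K) : ClassSemigroup R K →* ClassSemigroup T K :=
  (principalCon R K).lift (fracClass.comp (extendFracHom T)) fun I J h => by
    obtain ⟨x, hx⟩ := fracClass_eq_iff.1 ((principalCon R K).eq.2 h)
    refine fracClass_eq_iff.2 ⟨x, ?_⟩
    rw [← hx, ← extendFrac_principalFrac]
    exact (extendFrac_mul T _ _).symm

@[simp]
theorem extendClass_fracClass (T : Subalgebra R K) (I : nonzeroFractionalIdeals R K) :
    extendClass T (fracClass I) = fracClass (extendFrac T I) := rfl

theorem extendFrac_coeIdeal (T : Subalgebra R K) (I : nonzeroFractionalIdeals R K) (I₀ : Ideal R)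
    (h : (I : FractionalIdeal R⁰ K) = I₀) :
    (extendFrac T I : FractionalIdeal T⁰ K) = (I₀.map (algebraMap R T) : Ideal T) := by
  change FractionalIdeal.extendedHom K T (I : FractionalIdeal R⁰ K) = _
  rw [h, FractionalIdeal.extendedHom_coeIdeal_eq_map]

/-- A nonzero ideal, regarded as a nonzero fractional ideal. -/
def idealFrac (K : Type*) [Field K] [Algebra R K] [IsFractionRing R K] (I : Ideal R) (hI : I ≠ ⊥) :
    nonzeroFractionalIdeals R K := ⟨I, FractionalIdeal.coeIdeal_ne_zero.2 hI⟩

theorem extendFrac_idealFrac (P : PrimeSpectrum R) (hP : P.asIdeal ≠ ⊥) :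
    extendFrac (localizationAt K P) (idealFrac K P.asIdeal hP) = localIdeal K P hP :=
  Subtype.ext (extendFrac_coeIdeal _ _ _ rfl)

section Restrict

variable {D : Subalgebra R K} (hD : IsFractionalOverring D)

theorem mem_restrictFrac {A : nonzeroFractionalIdeals D K} {x : K} :
    x ∈ (restrictFrac D hD A : FractionalIdeal R⁰ K) ↔ x ∈ (A : FractionalIdeal D⁰ K) := Iff.rfl

theorem restrictFrac_injective : Function.Injective (restrictFrac D hD) := fun A B h =>
  Subtype.ext (SetLike.ext fun x => by
    rw [← mem_restrictFrac hD, h, mem_restrictFrac hD])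

theorem restrictFrac_mul (A B : nonzeroFractionalIdeals D K) :
    restrictFrac D hD (A * B) = restrictFrac D hD A * restrictFrac D hD B := by
  apply Subtype.ext
  refine le_antisymm (fun x hx => ?_) (FractionalIdeal.mul_le.2 fun i hi j hj => ?_)
  · refine FractionalIdeal.mul_induction_on (show x ∈
      (A : FractionalIdeal D⁰ K) * (B : FractionalIdeal D⁰ K) from hx) (fun i hi j hj => ?_)
      fun x y hx hy => ?_
    · exact FractionalIdeal.mul_mem_mul (I := (restrictFrac D hD A : FractionalIdeal R⁰ K)) hi hj
    · exact ((restrictFrac D hD A * restrictFrac D hD B : nonzeroFractionalIdeals R K) :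
        FractionalIdeal R⁰ K).1.add_mem hx hy
  · exact FractionalIdeal.mul_mem_mul (I := (A : FractionalIdeal D⁰ K)) hi hj

/-- A fractional overring, as a nonzero fractional ideal of `R`. -/
def overringFrac : nonzeroFractionalIdeals R K := restrictFrac D hD 1

theorem coe_overringFrac : (overringFrac hD : FractionalIdeal R⁰ K) = overringIdeal D hD :=
  SetLike.ext fun x => by
    change x ∈ (1 : FractionalIdeal D⁰ K) ↔ x ∈ D
    rw [FractionalIdeal.mem_one_iff]
    exact ⟨fun ⟨d, hd⟩ => hd ▸ d.2, fun h => ⟨⟨x, h⟩, rfl⟩⟩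

@[simp]
theorem restrictFrac_mul_overringFrac (A : nonzeroFractionalIdeals D K) :
    restrictFrac D hD A * overringFrac hD = restrictFrac D hD A := by
  rw [overringFrac, ← restrictFrac_mul, mul_one]

theorem extendFrac_restrictFrac (A : nonzeroFractionalIdeals D K) :
    extendFrac D (restrictFrac D hD A) = A := by
  apply Subtype.ext
  apply FractionalIdeal.coeToSubmodule_injective
  beta_reduce
  rw [coe_extendFrac]
  exact Submodule.span_eq (A : FractionalIdeal D⁰ K).1

theorem restrictFrac_extendFrac (X : nonzeroFractionalIdeals R K) :
    restrictFrac D hD (extendFrac D X) = X * overringFrac hD := by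
  apply Subtype.ext
  refine le_antisymm (fun x hx => ?_) (FractionalIdeal.mul_le.2 fun i hi j hj => ?_)
  · have hx' : x ∈ ((extendFrac D X : FractionalIdeal D⁰ K) : Submodule D K) := hx
    rw [coe_extendFrac] at hx'
    rw [Submonoid.coe_mul, coe_overringFrac]
    refine Submodule.closure_induction ?_ ?_ ?_ hx'
    · exact (X * overringIdeal D hD : FractionalIdeal R⁰ K).1.zero_mem
    · intro x y _ _ hx hy
      exact (X * overringIdeal D hD : FractionalIdeal R⁰ K).1.add_mem hx hy
    · rintro d x hx
      have := FractionalIdeal.mul_mem_mul (J := overringIdeal D hD) hx d.2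
      rwa [mul_comm x] at this
  · rw [coe_overringFrac] at hj
    have hj' : j ∈ D := hj
    change i * j ∈ ((extendFrac D X : FractionalIdeal D⁰ K) : Submodule D K)
    rw [coe_extendFrac, mul_comm]
    exact Submodule.smul_mem _ (⟨j, hj'⟩ : D) (Submodule.subset_span hi)

theorem restrictFrac_extendFrac_of_mul_eq {X : nonzeroFractionalIdeals R K}
    (hX : X * overringFrac hD = X) : restrictFrac D hD (extendFrac D X) = X := by
  rw [restrictFrac_extendFrac, hX]

theorem restrictFrac_principalFrac_mul (x : Kˣ) (A : nonzeroFractionalIdeals D K) :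
    restrictFrac D hD (principalFrac D x * A) = principalFrac R x * restrictFrac D hD A := by
  apply Subtype.ext
  refine SetLike.ext fun y => ?_
  rw [mem_restrictFrac, mem_principalFrac_mul, mem_principalFrac_mul]
  rfl

end Restrict

end

/-! ### Constituent groups -/

section

variable {S S' : Type*} [CommMonoid S] [CommMonoid S']

/-- The homomorphism of constituent groups induced by a homomorphism of semigroups. -/
def ConstituentGroup.map (f : S →* S') {e : S} {he : IsIdempotentElem e} {e' : S'}
    {he' : IsIdempotentElem e'} (h : f e = e') : ConstituentGroup he →* ConstituentGroup he' where
  toFun x := ⟨f x, by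
    obtain ⟨x, a, b, rfl, hab⟩ := x
    exact ⟨f a, f b, by rw [map_mul, h], by rw [← h, ← map_mul, ← map_mul, hab]⟩⟩
  map_one' := ConstituentGroup.ext h
  map_mul' x y := ConstituentGroup.ext (map_mul f (x : S) y)

theorem ConstituentGroup.mul_eq {e : S} {he : IsIdempotentElem e} (x : ConstituentGroup he) :
    x.1 * e = x.1 := congrArg Subtype.val (mul_one x)

/-- The element `x` of the constituent group of `e`, with an inverse `y` modulo `e`. -/
def ConstituentGroup.mk {e : S} (he : IsIdempotentElem e) (x y : S) (hx : x * e = x)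
    (hxy : x * y = e) : ConstituentGroup he := ⟨x, x, y, hx.symm, by rw [hxy, he.eq]⟩

end

section

variable {R K : Type*} [CommRing R] [IsDomain R] [Field K] [Algebra R K] [IsFractionRing R K]

/-- An element of the constituent group of the class of an idempotent ideal `L` and its inverse have
representatives for which the defining relations hold on the nose. -/
theorem ConstituentGroup.exists_rep {L : nonzeroFractionalIdeals R K} (hL : IsIdempotentElem L)
    (g : ConstituentGroup (hL.map fracClass)) :
    ∃ X Y : nonzeroFractionalIdeals R K, g.1 = fracClass X ∧
      X * Y = L ∧ X * L = X ∧ Y * L = Y := by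
  obtain ⟨X₀, hX₀⟩ := (principalCon R K).mk'_surjective g.1
  obtain ⟨Y₀, hY₀⟩ := (principalCon R K).mk'_surjective g⁻¹.1
  change fracClass X₀ = _ at hX₀
  change fracClass Y₀ = _ at hY₀
  have h : fracClass ((X₀ * L) * (Y₀ * L)) = fracClass L := by
    have := congrArg Subtype.val (mul_inv_cancel g)
    rw [fracClass.map_mul, fracClass.map_mul, fracClass.map_mul, hX₀, hY₀,
      ConstituentGroup.mul_eq g, ConstituentGroup.mul_eq g⁻¹]
    exact this
  obtain ⟨x, hx⟩ := fracClass_eq_iff.1 h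
  refine ⟨X₀ * L, principalFrac R x * (Y₀ * L), ?_, ?_, ?_, ?_⟩
  · rw [fracClass.map_mul, hX₀, ConstituentGroup.mul_eq g]
  · rw [mul_left_comm, hx]
  · rw [mul_assoc, hL.eq]
  · rw [mul_assoc, mul_assoc, hL.eq]

end

section

variable {R K : Type*} [CommRing R] [IsDomain R] [Field K] [Algebra R K] [IsFractionRing R K]

/-! ### The structure of idempotent fractional ideals -/

/-- The ring `(L : L)` of multipliers of a fractional ideal. -/
def multiplierRing (L : FractionalIdeal R⁰ K) : Subalgebra R K where
  carrier := {x | ∀ l ∈ L, x * l ∈ L}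
  mul_mem' {x y} hx hy l hl := by
    rw [mul_assoc]
    exact hx _ (hy l hl)
  add_mem' {x y} hx hy l hl := by
    rw [add_mul]
    exact L.1.add_mem (hx l hl) (hy l hl)
  algebraMap_mem' r l hl := by
    rw [← Algebra.smul_def]
    exact L.1.smul_mem r hl

theorem isFractionalOverring_multiplierRing {L : FractionalIdeal R⁰ K} (hL : L ≠ 0) :
    IsFractionalOverring (multiplierRing L) := by
  obtain ⟨l, hl, hl0⟩ := exists_mem_ne_zero hL
  obtain ⟨a, b, hb, rfl⟩ := IsFractionRing.div_surjective (A := R) l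
  have hb0 : algebraMap R K b ≠ 0 := IsFractionRing.to_map_ne_zero_of_mem_nonZeroDivisors hb
  have ha0 : a ≠ 0 := by
    rintro rfl
    simp at hl0
  obtain ⟨c, hc, hcL⟩ := L.2
  refine ⟨c * a, mul_mem hc (mem_nonZeroDivisors_of_ne_zero ha0), fun x hx => ?_⟩
  obtain ⟨r, hr⟩ := hcL _ (hx _ hl)
  refine ⟨b * r, ?_⟩
  rw [map_mul, hr, Algebra.smul_def, Algebra.smul_def, map_mul]
  field_simp

theorem mul_overringFrac_multiplierRing (L : nonzeroFractionalIdeals R K)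
    (hD : IsFractionalOverring (multiplierRing (L : FractionalIdeal R⁰ K))) :
    L * overringFrac hD = L := by
  apply Subtype.ext
  rw [Submonoid.coe_mul, coe_overringFrac]
  refine le_antisymm (FractionalIdeal.mul_le.2 fun i hi j hj => ?_) fun x hx => ?_
  · rw [mul_comm]
    exact hj i hi
  · have := FractionalIdeal.mul_mem_mul (J := overringIdeal _ hD) hx
      (one_mem (multiplierRing (L : FractionalIdeal R⁰ K)))
    rwa [mul_one] at this

/-- A nonzero idempotent fractional ideal `L` is an ideal of `D = (L : L)`, so it is a product of
idempotent maximal ideals of `D`, and these are extended from idempotent primes of `R`. The empty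
product gives `L = D`. -/
theorem eq_overringIdeal_or_isPrimeProduct (hR : HasSplitting R K) (hfc : HasFiniteCharacter R)
    {L : nonzeroFractionalIdeals R K} (hL : IsIdempotentElem L) :
    (∃ (D : Subalgebra R K) (hD : IsFractionalOverring D),
      (L : FractionalIdeal R⁰ K) = overringIdeal D hD) ∨
    (∃ (D : Subalgebra R K) (hD : IsFractionalOverring D) (n : ℕ)
      (P : Fin n → PrimeSpectrum R), IsPrimeProduct D hD P L) := by
  set D := multiplierRing (L : FractionalIdeal R⁰ K) with hDdef
  have hD : IsFractionalOverring D := isFractionalOverring_multiplierRing L.2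
  have hLD : restrictFrac D hD (extendFrac D L) = L :=
    restrictFrac_extendFrac_of_mul_eq hD (mul_overringFrac_multiplierRing L hD)
  have hmem (x : K) : x ∈ (extendFrac D L : FractionalIdeal D⁰ K) ↔
      x ∈ (L : FractionalIdeal R⁰ K) := by
    rw [← mem_restrictFrac hD, hLD]
  have hle : (extendFrac D L : FractionalIdeal D⁰ K) ≤ 1 := fun x hx => by
    rw [FractionalIdeal.mem_one_iff]
    refine ⟨⟨x, fun l hl => ?_⟩, rfl⟩
    have h := FractionalIdeal.mul_mem_mul ((hmem x).1 hx) hl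
    rwa [← Submonoid.coe_mul, hL.eq] at h
  obtain ⟨I, hI⟩ := FractionalIdeal.le_one_iff_exists_coeIdeal.1 hle
  have hmemI (d : D) : d ∈ I ↔ (d : K) ∈ (L : FractionalIdeal R⁰ K) := by
    rw [← hmem, ← hI, FractionalIdeal.mem_coeIdeal]
    exact ⟨fun h => ⟨d, h, rfl⟩, fun ⟨e, he, h⟩ => (Subtype.ext h : e = d) ▸ he⟩
  have hLI (l : K) (hl : l ∈ (L : FractionalIdeal R⁰ K)) : ∃ i ∈ I, (i : K) = l := by
    rw [← hmem, ← hI, FractionalIdeal.mem_coeIdeal] at hl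
    exact hl
  have hI0 : I ≠ ⊥ := by
    rintro rfl
    exact (extendFrac D L).2 (hI.symm.trans FractionalIdeal.coeIdeal_bot)
  have hII : IsIdempotentElem I := by
    refine FractionalIdeal.coeIdeal_injective (K := K) ?_
    have := congrArg Subtype.val (extendFrac_mul D L L)
    rw [hL.eq, Submonoid.coe_mul, ← hI, ← FractionalIdeal.coeIdeal_mul] at this
    exact this.symm
  obtain ⟨n, N, hN, hinj, hNN, hprod⟩ := exists_eq_prod_of_isIdempotentElem (K := K)
    (hR.subalgebra D) (hfc.subalgebra hR D) hII hI0 (fun r q hq h => by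
      have hq0 : (q : K) ≠ 0 := fun h0 => hq (Subtype.ext h0)
      have hx : (r : K) / q ∈ D := fun l hl => by
        obtain ⟨i, hi, rfl⟩ := hLI l hl
        obtain ⟨l', hl', e⟩ := h i hi
        have e' : (r : K) * i = q * l' := congrArg Subtype.val e
        rw [div_mul_eq_mul_div, e', mul_div_cancel_left₀ _ hq0]
        exact (hmemI l').1 hl'
      exact ⟨⟨_, hx⟩, Subtype.ext (mul_div_cancel₀ _ hq0).symm⟩)
  rcases Nat.eq_zero_or_pos n with rfl | hn
  · left
    refine ⟨D, hD, ?_⟩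
    have : extendFrac D L = 1 := Subtype.ext (by
      rw [← hI, hprod, Fin.prod_univ_zero, Ideal.one_eq_top]
      exact FractionalIdeal.coeIdeal_top D⁰ (P := K))
    rw [← coe_overringFrac, overringFrac, ← this, hLD]
  · right
    have hmap (i : Fin n) : ((N i).comap (algebraMap R D)).map (algebraMap R D) = N i :=
      hR.map_comap_eq _
    have hNbot (i : Fin n) : N i ≠ ⊥ := fun h => hI0 (by
      rw [hprod, Finset.prod_eq_zero (Finset.mem_univ i) h]; rfl)
    have hbot (i : Fin n) := comap_ne_bot (hNbot i)
    refine ⟨D, hD, n, fun i => ⟨(N i).comap (algebraMap R D), (hN i).isPrime.comap _⟩, hn,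
      fun i j h => hinj ?_, hbot, fun i => hR.isIdempotentElem_comap (hN i) (hNN i),
      fun i => ?_, ?_⟩
    · have h' : (N i).comap (algebraMap R D) = (N j).comap (algebraMap R D) :=
        congrArg PrimeSpectrum.asIdeal h
      rw [← hmap i, ← hmap j, h']
    · rw [hmap]
      exact hN i
    · set Q : nonzeroFractionalIdeals R K := ∏ i, idealFrac K _ (hbot i) with hQ
      have hext : extendFrac D L = extendFrac D Q := by
        have hQ' : extendFrac D Q = ∏ i, extendFrac D (idealFrac K _ (hbot i)) :=
          map_prod (extendFracHom D) _ _
        apply Subtype.ext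
        rw [hQ', ← hI, hprod, Submonoid.coe_finsetProd]
        have (i : Fin n) :
            (extendFrac D (idealFrac K _ (hbot i)) : FractionalIdeal D⁰ K) = N i := by
          rw [extendFrac_coeIdeal D _ _ rfl, hmap]
        simp only [this]
        exact map_prod (FractionalIdeal.coeIdealHom D⁰ K) _ _
      have := restrictFrac_extendFrac hD Q
      rw [← hext, hLD] at this
      rw [this, Submonoid.coe_mul, coe_overringFrac, hQ, Submonoid.coe_finsetProd]
      rfl

/-! ### Localization of fractional ideals of an overring -/

section Local

variable (hR : HasSplitting R K) {D : Subalgebra R K} (hD : IsFractionalOverring D)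
  {P : PrimeSpectrum R} (hP : (P.asIdeal.map (algebraMap R D)).IsMaximal)
include hR hP

theorem le_localizationAt : D ≤ localizationAt K P := fun x hx =>
  mem_localizationAt.2 (hR.exists_smul_eq_of_map_ne_top hP.ne_top ⟨x, hx⟩)

theorem inv_mem_localizationAt {s : D} (hs : s ∉ P.asIdeal.map (algebraMap R D)) :
    (s : K)⁻¹ ∈ localizationAt K P := by
  obtain ⟨t, r, hr, h⟩ := hR.exists_mul_notMem hP hs
  obtain ⟨u, hu, r', h'⟩ := hR.exists_smul_eq_of_map_ne_top hP.ne_top t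
  have hs0 : (s : K) ≠ 0 := fun h0 => hs (by
    rw [show s = 0 from Subtype.ext h0]; exact zero_mem _)
  refine mem_localizationAt.2 ⟨u * r, fun h => (P.isPrime.mem_or_mem h).elim hu hr, r', ?_⟩
  have e : (t : K) * s = algebraMap R K r := congrArg Subtype.val h
  rw [← h', Algebra.smul_def, Algebra.smul_def, map_mul, ← e]
  field_simp

include hD

theorem mem_extendFrac_restrictFrac {A : nonzeroFractionalIdeals D K} {x : K} :
    x ∈ (extendFrac (localizationAt K P) (restrictFrac D hD A) :
      FractionalIdeal (localizationAt K P)⁰ K) ↔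
    ∃ s ∉ P.asIdeal.map (algebraMap R D), s • x ∈ (A : FractionalIdeal D⁰ K) := by
  rw [mem_extendFrac_localizationAt]
  constructor
  · rintro ⟨s, hs, h⟩
    refine ⟨algebraMap R D s, fun h' => hs ?_, ?_⟩
    · rwa [← Ideal.mem_comap, hR.comap_map_eq hP.ne_top] at h'
    · rwa [algebraMap_smul]
  · rintro ⟨s, hs, h⟩
    obtain ⟨t, r, hr, e⟩ := hR.exists_mul_notMem hP hs
    refine ⟨r, hr, ?_⟩
    have := (A : FractionalIdeal D⁰ K).1.smul_mem t h
    rw [smul_smul, e, algebraMap_smul] at this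
    exact this

theorem extendFrac_overringFrac : extendFrac (localizationAt K P) (overringFrac hD) = 1 := by
  rw [← show extendFrac (localizationAt K P) (1 : nonzeroFractionalIdeals R K) = 1 from
    map_one (extendFracHom _)]
  apply Subtype.ext
  refine SetLike.ext fun x => ?_
  rw [mem_extendFrac_localizationAt, mem_extendFrac_localizationAt]
  constructor
  · rintro ⟨s, hs, h⟩
    rw [coe_overringFrac] at h
    have h' : s • x ∈ D := h
    obtain ⟨t, ht, r, e⟩ := hR.exists_smul_eq_of_map_ne_top hP.ne_top ⟨_, h'⟩
    refine ⟨t * s, fun h => (P.isPrime.mem_or_mem h).elim ht hs, ?_⟩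
    rw [mul_smul]
    exact (FractionalIdeal.mem_one_iff R⁰).2 ⟨r, e.symm⟩
  · rintro ⟨s, hs, h⟩
    obtain ⟨r, e⟩ := (FractionalIdeal.mem_one_iff R⁰).1 h
    refine ⟨s, hs, ?_⟩
    rw [coe_overringFrac, ← e]
    exact D.algebraMap_mem r

theorem extendFrac_restrictFrac_extendFrac (X : nonzeroFractionalIdeals R K) :
    extendFrac (localizationAt K P) (restrictFrac D hD (extendFrac D X)) =
      extendFrac (localizationAt K P) X := by
  rw [restrictFrac_extendFrac, extendFrac_mul, extendFrac_overringFrac hR hD hP, mul_one]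

/-- `R_P` is the localization of `D` at `P D`. -/
theorem mem_one_localizationAt {x : K} :
    x ∈ (1 : FractionalIdeal (localizationAt K P)⁰ K) ↔
      ∃ s ∉ P.asIdeal.map (algebraMap R D), ∃ d : D, s • x = d := by
  have h := mem_extendFrac_restrictFrac hR hD hP (A := 1) (x := x)
  rw [show restrictFrac D hD 1 = overringFrac hD from rfl, extendFrac_overringFrac hR hD hP] at h
  refine h.trans (exists_congr fun s => and_congr_right fun _ => ?_)
  exact (FractionalIdeal.mem_one_iff D⁰).trans (exists_congr fun d => eq_comm)

/-- `P R_P` is the localization of `P D`. -/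
theorem mem_localIdeal (hP0 : P.asIdeal ≠ ⊥) {x : K} :
    x ∈ (localIdeal K P hP0 : FractionalIdeal (localizationAt K P)⁰ K) ↔
      ∃ s ∉ P.asIdeal.map (algebraMap R D), ∃ m ∈ P.asIdeal.map (algebraMap R D), s • x = m := by
  rw [← extendFrac_idealFrac, ← extendFrac_restrictFrac_extendFrac hR hD hP,
    mem_extendFrac_restrictFrac hR hD hP, extendFrac_coeIdeal D _ P.asIdeal rfl]
  refine exists_congr fun s => and_congr_right fun _ => ?_
  exact (FractionalIdeal.mem_coeIdeal D⁰).trans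
    (exists_congr fun d => and_congr_right fun _ => eq_comm)

/-- An invertible ideal `A` is locally principal: `a` generates `A` at `P D` if `a b ∉ P D` for some
`b ∈ A⁻¹`. -/
theorem exists_extendFrac_ofUnit_eq (A : (FractionalIdeal D⁰ K)ˣ) :
    ∃ x : Kˣ, extendFrac (localizationAt K P) (restrictFrac D hD (ofUnit A)) =
      principalFrac (localizationAt K P) x := by
  set M := P.asIdeal.map (algebraMap R D) with hM
  have h1 : ¬ ((A : FractionalIdeal D⁰ K) * (A⁻¹ : (FractionalIdeal D⁰ K)ˣ)) ≤ M := by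
    rw [Units.mul_inv]
    intro hle
    obtain ⟨m, hm, h⟩ := (FractionalIdeal.mem_coeIdeal D⁰).1
      (hle (FractionalIdeal.one_mem_one D⁰))
    exact hP.ne_top ((Ideal.eq_top_iff_one _).2
      ((show m = 1 from Subtype.ext h) ▸ hm))
  have hAA (a b : K) (ha : a ∈ (A : FractionalIdeal D⁰ K))
      (hb : b ∈ ((A⁻¹ : (FractionalIdeal D⁰ K)ˣ) : FractionalIdeal D⁰ K)) :
      ∃ d : D, (d : K) = a * b := by
    have := FractionalIdeal.mul_mem_mul ha hb
    rwa [Units.mul_inv, FractionalIdeal.mem_one_iff] at this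
  obtain ⟨a, ha, b, hb, s, hs, e⟩ : ∃ a ∈ (A : FractionalIdeal D⁰ K),
      ∃ b ∈ ((A⁻¹ : (FractionalIdeal D⁰ K)ˣ) : FractionalIdeal D⁰ K),
        ∃ s ∉ M, (s : K) = a * b := by
    by_contra! H
    refine h1 (FractionalIdeal.mul_le.2 fun a ha b hb => ?_)
    obtain ⟨d, hd⟩ := hAA a b ha hb
    by_cases hdM : d ∈ M
    · exact (FractionalIdeal.mem_coeIdeal D⁰).2 ⟨d, hdM, hd⟩
    · exact absurd hd (H a ha b hb d hdM)
  have ha0 : a ≠ 0 := by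
    rintro rfl
    rw [zero_mul] at e
    exact hs ((show s = 0 from Subtype.ext e) ▸ M.zero_mem)
  refine ⟨Units.mk0 a ha0, Subtype.ext (SetLike.ext fun y => ?_)⟩
  rw [mem_extendFrac_restrictFrac hR hD hP, ← mul_one (principalFrac _ _), mem_principalFrac_mul]
  constructor
  · rintro ⟨t, ht, hy⟩
    obtain ⟨d, hd⟩ := hAA _ b hy hb
    refine ⟨a⁻¹ * y, (mem_one_localizationAt hR hD hP).2 ⟨s * t,
      fun h => (hP.isPrime.mem_or_mem h).elim hs ht, d, ?_⟩, by
        rw [Units.val_mk0, mul_inv_cancel_left₀ ha0]⟩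
    rw [hd, Algebra.smul_def, Algebra.smul_def, map_mul]
    change (s : K) * t * _ = t * y * b
    rw [e]
    field_simp
  · rintro ⟨z, hz, rfl⟩
    obtain ⟨t, ht, d, hd⟩ := (mem_one_localizationAt hR hD hP).1 hz
    refine ⟨t, ht, ?_⟩
    rw [Units.val_mk0, mul_comm, ← smul_mul_assoc, hd]
    exact (A : FractionalIdeal D⁰ K).1.smul_mem d ha

end Local

end

noncomputable section

variable {R K : Type*} [CommRing R] [IsDomain R] [Field K] [Algebra R K] [IsFractionRing R K]

section

variable {D : Subalgebra R K} {hD : IsFractionalOverring D} {n : ℕ} {P : Fin n → PrimeSpectrum R}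
  {L : nonzeroFractionalIdeals R K}

/-! ### The exact sequence -/

theorem IsPrimeProduct.mul_overringFrac (h : IsPrimeProduct D hD P L) :
    L * overringFrac hD = L := by
  apply Subtype.ext
  have e : overringFrac hD * overringFrac hD = overringFrac hD :=
    restrictFrac_mul_overringFrac hD 1
  have e' := congrArg Subtype.val e
  rw [Submonoid.coe_mul, coe_overringFrac] at e'
  rw [Submonoid.coe_mul, h.eq, coe_overringFrac, mul_assoc, e']

theorem IsPrimeProduct.coe_extendFrac (h : IsPrimeProduct D hD P L) :
    (extendFrac D L : FractionalIdeal D⁰ K) =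
      (∏ i, (P i).asIdeal.map (algebraMap R D) : Ideal D) := by
  set Q : nonzeroFractionalIdeals R K := ∏ i, idealFrac K _ (h.ne_bot i) with hQ
  have hL : L = restrictFrac D hD (extendFrac D Q) := by
    rw [restrictFrac_extendFrac]
    apply Subtype.ext
    rw [h.eq, Submonoid.coe_mul, coe_overringFrac, hQ, Submonoid.coe_finsetProd]
    rfl
  have hQ' : extendFrac D Q = ∏ i, extendFrac D (idealFrac K _ (h.ne_bot i)) :=
    map_prod (extendFracHom D) _ _
  rw [hL, extendFrac_restrictFrac, hQ', Submonoid.coe_finsetProd]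
  simp only [extendFrac_coeIdeal D (idealFrac K _ (h.ne_bot _)) _ rfl]
  exact (map_prod (FractionalIdeal.coeIdealHom D⁰ K) _ _).symm

theorem IsPrimeProduct.map_injective (hR : HasSplitting R K) (h : IsPrimeProduct D hD P L) :
    Function.Injective fun i => (P i).asIdeal.map (algebraMap R D) := fun i j hij =>
  h.injective (PrimeSpectrum.ext (by
    rw [← hR.comap_map_eq (h.maximal i).ne_top, ← hR.comap_map_eq (h.maximal j).ne_top]
    exact congrArg _ hij))

theorem IsPrimeProduct.isLocallyMaximal (hR : HasSplitting R K) (h : IsPrimeProduct D hD P L) :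
    IsLocallyMaximal (∏ i, (P i).asIdeal.map (algebraMap R D)) :=
  IsLocallyMaximal.prod h.maximal (h.map_injective hR)

theorem IsPrimeProduct.restrictFrac_extendFrac (h : IsPrimeProduct D hD P L) :
    restrictFrac D hD (extendFrac D L) = L :=
  restrictFrac_extendFrac_of_mul_eq hD h.mul_overringFrac

theorem prod_map_le (i : Fin n) :
    ∏ i, (P i).asIdeal.map (algebraMap R D) ≤ (P i).asIdeal.map (algebraMap R D) :=
  Ideal.prod_le_inf.trans (Finset.inf_le (Finset.mem_univ i))

theorem IsPrimeProduct.prod_ne_bot (h : IsPrimeProduct D hD P L) :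
    ∏ i, (P i).asIdeal.map (algebraMap R D) ≠ ⊥ := fun h0 =>
  (extendFrac D L).2 (by rw [h.coe_extendFrac, h0, FractionalIdeal.coeIdeal_bot])

theorem IsPrimeProduct.extendFrac_localizationAt (hR : HasSplitting R K)
    (h : IsPrimeProduct D hD P L) (i : Fin n) :
    extendFrac (localizationAt K (P i)) L = localIdeal K (P i) (h.ne_bot i) := by
  have hM := h.maximal i
  conv_lhs => rw [← h.restrictFrac_extendFrac]
  refine Subtype.ext (SetLike.ext fun x => ?_)
  rw [mem_extendFrac_restrictFrac hR hD hM, mem_localIdeal hR hD hM, h.coe_extendFrac]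
  constructor
  · rintro ⟨s, hs, hx⟩
    obtain ⟨m, hm, e⟩ := (FractionalIdeal.mem_coeIdeal D⁰).1 hx
    exact ⟨s, hs, m, prod_map_le i hm, e.symm⟩
  · rintro ⟨s, hs, m, hm, e⟩
    obtain ⟨q, hq, hqm⟩ := h.isLocallyMaximal hR _ hM (prod_map_le i)
    refine ⟨q * s, fun h => (hM.isPrime.mem_or_mem h).elim hq hs,
      (FractionalIdeal.mem_coeIdeal D⁰).2 ⟨q * m, hqm m hm, ?_⟩⟩
    rw [mul_smul, e, map_mul, Algebra.smul_def]
    rfl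

theorem restrictFrac_ofUnit_mul_inv (A : (FractionalIdeal D⁰ K)ˣ) :
    restrictFrac D hD (ofUnit A) * restrictFrac D hD (ofUnit A⁻¹) = overringFrac hD := by
  rw [← restrictFrac_mul, overringFrac]
  exact congrArg _ (Subtype.ext (A.mul_inv))

theorem ClassGroup.mk_surjective {A : Type*} (K : Type*) [CommRing A] [IsDomain A] [Field K]
    [Algebra A K] [IsFractionRing A K] (c : ClassGroup A) :
    ∃ I : (FractionalIdeal A⁰ K)ˣ, ClassGroup.mk K I = c :=
  ClassGroup.induction K (P := fun c => ∃ I : (FractionalIdeal A⁰ K)ˣ, ClassGroup.mk K I = c)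
    (fun I => ⟨I, rfl⟩) c

/-- The homomorphism `A ↦ class of A L` on the invertible fractional ideals of `D`. -/
def unitsToConstituent (hL : IsIdempotentElem L) (hLD : L * overringFrac hD = L) :
    (FractionalIdeal D⁰ K)ˣ →* ConstituentGroup (hL.map fracClass) where
  toFun A := ConstituentGroup.mk _ (fracClass (restrictFrac D hD (ofUnit A) * L))
    (fracClass (restrictFrac D hD (ofUnit A⁻¹) * L))
    (by rw [← fracClass.map_mul, mul_assoc, hL.eq])
    (by rw [← fracClass.map_mul, mul_mul_mul_comm, restrictFrac_ofUnit_mul_inv, hL.eq,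
      mul_comm, hLD])
  map_one' := ConstituentGroup.ext (by
    change fracClass (overringFrac hD * L) = fracClass L
    rw [mul_comm, hLD])
  map_mul' A B := ConstituentGroup.ext (by
    change fracClass (restrictFrac D hD (ofUnit A * ofUnit B) * L) =
      fracClass (restrictFrac D hD (ofUnit A) * L) * fracClass (restrictFrac D hD (ofUnit B) * L)
    rw [← fracClass.map_mul, mul_mul_mul_comm, hL.eq, restrictFrac_mul])

theorem unitsToConstituent_toPrincipalIdeal (hL : IsIdempotentElem L)
    (hLD : L * overringFrac hD = L) (x : Kˣ) :
    unitsToConstituent hL hLD (toPrincipalIdeal D K x) = 1 := ConstituentGroup.ext (by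
  change fracClass (restrictFrac D hD (ofUnit (toPrincipalIdeal D K x)) * L) = fracClass L
  have : ofUnit (toPrincipalIdeal D K x) = principalFrac D x * 1 := by
    rw [mul_one]
    exact Subtype.ext (coe_toPrincipalIdeal x)
  rw [this, restrictFrac_principalFrac_mul, mul_assoc, fracClass_principalFrac_mul,
    show restrictFrac D hD 1 = overringFrac hD from rfl, mul_comm, hLD])

/-- The homomorphism `[A] ↦ class of A L` on the class group of `D`. -/
def classGroupToConstituent (hL : IsIdempotentElem L) (hLD : L * overringFrac hD = L) :
    ClassGroup D →* ConstituentGroup (hL.map fracClass) :=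
  (QuotientGroup.lift (toPrincipalIdeal D K).range (unitsToConstituent hL hLD) (by
    rintro _ ⟨x, rfl⟩
    exact unitsToConstituent_toPrincipalIdeal hL hLD x)).comp (ClassGroup.equiv K).toMonoidHom

theorem classGroupToConstituent_mk (hL : IsIdempotentElem L) (hLD : L * overringFrac hD = L)
    (A : (FractionalIdeal D⁰ K)ˣ) :
    classGroupToConstituent hL hLD (ClassGroup.mk K A) = unitsToConstituent hL hLD A := by
  have : ClassGroup.equiv K (ClassGroup.mk K A) = QuotientGroup.mk A := by
    rw [ClassGroup.equiv_mk, QuotientGroup.mk'_apply]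
    congr 1
    ext1
    simp
  rw [classGroupToConstituent, MonoidHom.comp_apply, MulEquiv.toMonoidHom_eq_coe,
    MonoidHom.coe_coe, this]
  rfl

/-- If `x A L = L`, then `B = x A` satisfies `B L = L = B⁻¹ L`, and `(L : L) = D` forces `B = D`. -/
theorem IsPrimeProduct.classGroupToConstituent_injective (hR : HasSplitting R K)
    (h : IsPrimeProduct D hD P L) (hL : IsIdempotentElem L) :
    Function.Injective (classGroupToConstituent hL h.mul_overringFrac) := by
  rw [injective_iff_map_eq_one]
  intro c
  obtain ⟨A, rfl⟩ := ClassGroup.mk_surjective K c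
  intro hA
  rw [classGroupToConstituent_mk] at hA
  have hA' : fracClass (restrictFrac D hD (ofUnit A) * L) = fracClass L := congrArg Subtype.val hA
  obtain ⟨x, hx⟩ := fracClass_eq_iff.1 hA'
  set B := toPrincipalIdeal D K x * A with hB
  have hBL : (B : FractionalIdeal D⁰ K) * (extendFrac D L : FractionalIdeal D⁰ K) =
      (extendFrac D L : FractionalIdeal D⁰ K) := by
    have e : ofUnit B = principalFrac D x * ofUnit A := Subtype.ext (by
      change ((toPrincipalIdeal D K x * A : (FractionalIdeal D⁰ K)ˣ) : FractionalIdeal D⁰ K) = _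
      rw [Units.val_mul, coe_toPrincipalIdeal]
      rfl)
    have : ofUnit B * extendFrac D L = extendFrac D L := restrictFrac_injective hD (by
      rw [restrictFrac_mul, h.restrictFrac_extendFrac, e, restrictFrac_principalFrac_mul,
        mul_assoc, hx])
    exact congrArg Subtype.val this
  have hBL' : ((B⁻¹ : (FractionalIdeal D⁰ K)ˣ) : FractionalIdeal D⁰ K) *
      (extendFrac D L : FractionalIdeal D⁰ K) = (extendFrac D L : FractionalIdeal D⁰ K) :=
    (Units.inv_mul_eq_iff_eq_mul B).2 hBL.symm
  rw [h.coe_extendFrac] at hBL hBL'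
  have h1 := (h.isLocallyMaximal hR).le_one_of_mul_le (hR.subalgebra D) hBL.le
  have h2 := (h.isLocallyMaximal hR).le_one_of_mul_le (hR.subalgebra D) hBL'.le
  have hB1 : B = 1 := Units.ext (le_antisymm h1 (by
    calc (1 : FractionalIdeal D⁰ K) = B * (B⁻¹ : (FractionalIdeal D⁰ K)ˣ) := (Units.mul_inv B).symm
      _ ≤ B * 1 := by gcongr
      _ = B := mul_one _))
  apply (ClassGroup.equiv K).injective
  rw [map_one, ClassGroup.equiv_mk]
  have hrange : A ∈ (toPrincipalIdeal D K).range := by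
    have hA1 : A = (toPrincipalIdeal D K x)⁻¹ := eq_inv_of_mul_eq_one_right (hB ▸ hB1)
    rw [hA1]
    exact inv_mem ⟨x, rfl⟩
  simpa using hrange

/-- The homomorphism `class of X ↦ (class of X R_{P_i})_i`. -/
def IsPrimeProduct.localize (hR : HasSplitting R K)
    (h : IsPrimeProduct D hD P L) (hL : IsIdempotentElem L) :
    ConstituentGroup (hL.map fracClass) →* ∀ i, ConstituentGroup
      ((isIdempotentElem_localIdeal (K := K) (P i) (h.ne_bot i) (h.idempotent i)).map fracClass) :=
  MonoidHom.pi fun i => ConstituentGroup.map (extendClass (localizationAt K (P i))) (by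
    rw [extendClass_fracClass, h.extendFrac_localizationAt hR])

theorem IsPrimeProduct.coe_localize (hR : HasSplitting R K)
    (h : IsPrimeProduct D hD P L) (hL : IsIdempotentElem L)
    {g : ConstituentGroup (hL.map fracClass)} {X : nonzeroFractionalIdeals R K}
    (hg : g.1 = fracClass X) (i : Fin n) :
    (h.localize hR hL g i).1 = fracClass (extendFrac (localizationAt K (P i)) X) := by
  rw [← extendClass_fracClass, ← hg]
  rfl

theorem IsPrimeProduct.range_le_ker (hR : HasSplitting R K)
    (h : IsPrimeProduct D hD P L) (hL : IsIdempotentElem L) :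
    (classGroupToConstituent hL h.mul_overringFrac).range ≤ (h.localize hR hL).ker := by
  rintro _ ⟨c, rfl⟩
  obtain ⟨A, rfl⟩ := ClassGroup.mk_surjective K c
  rw [classGroupToConstituent_mk]
  refine funext fun i => ConstituentGroup.ext ?_
  refine (h.coe_localize hR hL (X := restrictFrac D hD (ofUnit A) * L) rfl i).trans ?_
  obtain ⟨x, hx⟩ := exists_extendFrac_ofUnit_eq hR hD (h.maximal i) A
  rw [extendFrac_mul, hx, fracClass_principalFrac_mul, h.extendFrac_localizationAt hR]
  rfl

theorem IsPrimeProduct.ker_le_range (hR : HasSplitting R K) (hfc : HasFiniteCharacter R)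
    (h : IsPrimeProduct D hD P L) (hL : IsIdempotentElem L) :
    (h.localize hR hL).ker ≤ (classGroupToConstituent hL h.mul_overringFrac).range := by
  intro g hg
  obtain ⟨X, Y, hgX, hXY, hX, hY⟩ := ConstituentGroup.exists_rep hL g
  have hmulD (Z : nonzeroFractionalIdeals R K) (hZ : Z * L = Z) :
      restrictFrac D hD (extendFrac D Z) = Z := restrictFrac_extendFrac_of_mul_eq hD (by
    rw [← hZ, mul_assoc, h.mul_overringFrac])
  have hext (Z W V : nonzeroFractionalIdeals R K) (hZ : Z * W = V) :
      (extendFrac D Z : FractionalIdeal D⁰ K) * (extendFrac D W : FractionalIdeal D⁰ K) =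
        (extendFrac D V : FractionalIdeal D⁰ K) := by
    rw [← hZ, extendFrac_mul, Submonoid.coe_mul]
  have hXY' := hext X Y L hXY
  have hX' := hext X L X hX
  have hY' := hext Y L Y hY
  rw [h.coe_extendFrac] at hXY' hX' hY'
  obtain ⟨B, hB⟩ := (h.isLocallyMaximal hR).exists_unit_mul_eq (hR.subalgebra D)
    (hfc.subalgebra hR D) h.prod_ne_bot hXY' hX' hY' (fun N hN hle => by
      obtain ⟨i, -, hi⟩ := (Ideal.IsPrime.prod_le hN.isPrime).1 hle
      obtain rfl := (h.maximal i).eq_of_le hN.ne_top hi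
      set E := localIdeal K (P i) (h.ne_bot i) with hE
      have hLE : extendFrac (localizationAt K (P i)) L = E := h.extendFrac_localizationAt hR i
      have hgi : fracClass E = fracClass (extendFrac (localizationAt K (P i)) X) := by
        rw [← h.coe_localize hR hL hgX i, MonoidHom.mem_ker.1 hg]
        rfl
      obtain ⟨x, hx⟩ := fracClass_eq_iff.1 hgi
      have hx' : principalFrac _ x * extendFrac (localizationAt K (P i)) Y = E := by
        rw [← hY, extendFrac_mul, hLE, mul_comm _ E, ← mul_assoc, hx, ← extendFrac_mul, hXY, hLE]
      have hmE (m : D) (hm : m ∈ (P i).asIdeal.map (algebraMap R D)) :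
          (m : K) ∈ (E : FractionalIdeal (localizationAt K (P i))⁰ K) :=
        (mem_localIdeal hR hD hN (h.ne_bot i)).2
          ⟨1, fun h1 => hN.ne_top ((Ideal.eq_top_iff_one _).2 h1), m, hm, one_smul _ _⟩
      refine ⟨x, x.ne_zero, fun m hm => ?_, fun m hm => ?_⟩
      · have h1 : (m : K) * x ∈ (extendFrac (localizationAt K (P i)) X :
            FractionalIdeal (localizationAt K (P i))⁰ K) := by
          rw [← hx, mul_comm (m : K), mul_mem_principalFrac_mul]
          exact hmE m hm
        rw [← hmulD X hX, mem_extendFrac_restrictFrac hR hD hN] at h1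
        exact h1
      · have h1 : (m : K) * (x : K)⁻¹ ∈ (extendFrac (localizationAt K (P i)) Y :
            FractionalIdeal (localizationAt K (P i))⁰ K) := by
          rw [← mul_mem_principalFrac_mul (x := x), hx', mul_left_comm, mul_inv_cancel₀ x.ne_zero,
            mul_one]
          exact hmE m hm
        rw [← hmulD Y hY, mem_extendFrac_restrictFrac hR hD hN] at h1
        exact h1)
  refine ⟨ClassGroup.mk K B, ?_⟩
  rw [classGroupToConstituent_mk]
  refine ConstituentGroup.ext ?_
  rw [hgX]
  change fracClass (restrictFrac D hD (ofUnit B) * L) = _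
  have : ofUnit B * extendFrac D L = extendFrac D X := Subtype.ext (by
    rw [Submonoid.coe_mul, h.coe_extendFrac]
    exact hB)
  rw [← hmulD X hX, ← this, restrictFrac_mul, h.restrictFrac_extendFrac]

/-- Inverse pairs with respect to `P R_P` lift, up to a scalar, to fractional ideals `X`, `Y` of `D`
with `X Y = P D` and `X` trivial at all other maximal ideals extended from `R`. -/
theorem exists_extendFrac_restrictFrac_eq (hR : HasSplitting R K) (hfc : HasFiniteCharacter R)
    (hD : IsFractionalOverring D) {P : PrimeSpectrum R}
    (hM : (P.asIdeal.map (algebraMap R D)).IsMaximal) (hP0 : P.asIdeal ≠ ⊥)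
    {Z Z' : nonzeroFractionalIdeals (localizationAt K P) K} (hZZ : Z * Z' = localIdeal K P hP0) :
    ∃ (a : Kˣ) (X Y : nonzeroFractionalIdeals D K),
      ((X * Y : nonzeroFractionalIdeals D K) : FractionalIdeal D⁰ K) =
        P.asIdeal.map (algebraMap R D) ∧
      principalFrac (localizationAt K P) a *
        extendFrac (localizationAt K P) (restrictFrac D hD X) = Z ∧
      ∀ Q : PrimeSpectrum R, (Q.asIdeal.map (algebraMap R D)).IsMaximal →
        Q.asIdeal.map (algebraMap R D) ≠ P.asIdeal.map (algebraMap R D) →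
        extendFrac (localizationAt K Q) (restrictFrac D hD X) = 1 := by
  set M := P.asIdeal.map (algebraMap R D) with hMdef
  have hDV (d : D) : (d : K) ∈ localizationAt K P := le_localizationAt hR hM d.2
  -- A fractional ideal of `R_P`, regarded as a `D`-submodule of `K`.
  let res (W : nonzeroFractionalIdeals (localizationAt K P) K) : Submodule D K :=
    { carrier := {x | x ∈ (W : FractionalIdeal (localizationAt K P)⁰ K)}
      add_mem' := fun hx hy => (W : FractionalIdeal (localizationAt K P)⁰ K).1.add_mem hx hy
      zero_mem' := (W : FractionalIdeal (localizationAt K P)⁰ K).1.zero_mem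
      smul_mem' := fun d x hx =>
        (W : FractionalIdeal (localizationAt K P)⁰ K).1.smul_mem ⟨d, hDV d⟩ hx }
  have hres (W : nonzeroFractionalIdeals (localizationAt K P) K) (s : D)
      (hs : s ∉ M) (z : K) (hz : s • z ∈ res W) : z ∈ res W := by
    have hs0 : (s : K) ≠ 0 := fun h0 => hs (by
      rw [show s = 0 from Subtype.ext h0]; exact zero_mem _)
    have := (W : FractionalIdeal (localizationAt K P)⁰ K).1.smul_mem
      ⟨_, inv_mem_localizationAt hR hM hs⟩ hz
    change (s : K)⁻¹ * (s * z) ∈ (W : FractionalIdeal (localizationAt K P)⁰ K) at this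
    rwa [inv_mul_cancel_left₀ hs0] at this
  have hM0 : M ≠ ⊥ := fun h0 => hP0 (le_bot_iff.1 fun p hp => by
    have : algebraMap R D p ∈ M := Ideal.mem_map_of_mem _ hp
    rw [h0, Ideal.mem_bot] at this
    exact IsFractionRing.injective R K (by rw [map_zero]; exact congrArg Subtype.val this))
  have hZZ' : (Z : FractionalIdeal (localizationAt K P)⁰ K) *
      (Z' : FractionalIdeal (localizationAt K P)⁰ K) = localIdeal K P hP0 :=
    congrArg Subtype.val hZZ
  obtain ⟨a, ha0, X, Y, hXY, h1X, hXN, hXZ, hZX⟩ :=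
    exists_mul_eq_of_localization_mul_eq (hR.subalgebra D) (hfc.subalgebra hR D) hM hM0
    (hres Z) (hres Z')
    (fun z hz z' hz' => by
      have := FractionalIdeal.mul_mem_mul (I := (Z : FractionalIdeal (localizationAt K P)⁰ K))
        hz hz'
      rw [hZZ'] at this
      exact (mem_localIdeal hR hD hM hP0).1 this)
    (fun m hm => by
      have hmE : (m : K) ∈ (localIdeal K P hP0 : FractionalIdeal (localizationAt K P)⁰ K) :=
        (mem_localIdeal hR hD hM hP0).2
          ⟨1, fun h1 => hM.ne_top ((Ideal.eq_top_iff_one _).2 h1), m, hm, one_smul _ _⟩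
      rw [← hZZ'] at hmE
      exact FractionalIdeal.mul_induction_on (C := fun y => y ∈ res Z * res Z') hmE
        (fun z hz z' hz' => Submodule.mul_mem_mul (M := res Z) (N := res Z') hz hz')
        fun x y hx hy => add_mem hx hy)
  have hMne : (M : FractionalIdeal D⁰ K) ≠ 0 := FractionalIdeal.coeIdeal_ne_zero.2 hM0
  refine ⟨Units.mk0 a ha0, ⟨X, fun h0 => hMne (by rw [← hXY, h0, zero_mul])⟩,
    ⟨Y, fun h0 => hMne (by rw [← hXY, h0, mul_zero])⟩, hXY, ?_, fun Q hQ hne => ?_⟩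
  · refine Subtype.ext (SetLike.ext fun y => ?_)
    rw [mem_principalFrac_mul]
    constructor
    · rintro ⟨z, hz, rfl⟩
      obtain ⟨s, hs, hsz⟩ := (mem_extendFrac_restrictFrac hR hD hM).1 hz
      refine hres Z s hs _ ?_
      rw [← mul_smul_comm]
      exact hXZ _ hsz
    · intro hy
      refine ⟨a⁻¹ * y, (mem_extendFrac_restrictFrac hR hD hM).2 ?_,
        (mul_inv_cancel_left₀ ha0 y).symm⟩
      obtain ⟨s, hs, x, hx, e⟩ := hZX y hy
      refine ⟨s, hs, ?_⟩
      rw [← mul_smul_comm, ← e, inv_mul_cancel_left₀ ha0]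
      exact hx
  · refine Subtype.ext (SetLike.ext fun y => ?_)
    rw [mem_extendFrac_restrictFrac hR hD hQ]
    refine Iff.trans ?_ (mem_one_localizationAt hR hD hQ).symm
    constructor
    · rintro ⟨s, hs, hy⟩
      obtain ⟨t, ht, d, e⟩ := hXN _ hQ hne _ hy
      exact ⟨t * s, fun h => (hQ.isPrime.mem_or_mem h).elim ht hs, d, by rw [mul_smul, e]; rfl⟩
    · rintro ⟨s, hs, d, e⟩
      refine ⟨s, hs, ?_⟩
      rw [e]
      have := X.1.smul_mem d h1X
      rwa [← Algebra.algebraMap_eq_smul_one] at this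

theorem mul_eq_of_eq_one {S : Type*} [Monoid S] {a b : S} (h : a = 1) : a * b = b := by
  rw [h, one_mul]

theorem Pi.eq_mulSingle {ι : Type*} [DecidableEq ι] {G : ι → Type*} [∀ i, One (G i)] {f : ∀ i, G i}
    {i : ι} {g : G i} (h : f i = g) (h' : ∀ j, j ≠ i → f j = 1) : f = Pi.mulSingle i g := by
  funext j
  rcases eq_or_ne j i with rfl | hji
  · rw [Pi.mulSingle_eq_same, h]
  · rw [Pi.mulSingle_eq_of_ne hji, h' j hji]

set_option maxHeartbeats 400000 in
/-- Every element supported at one factor of the product comes from `X L`, for the lift `X` of a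
representative. -/
theorem IsPrimeProduct.mulSingle_mem_range_localize (hR : HasSplitting R K)
    (hfc : HasFiniteCharacter R) (h : IsPrimeProduct D hD P L) (hL : IsIdempotentElem L)
    (i : Fin n) (g : ConstituentGroup
      ((isIdempotentElem_localIdeal (K := K) (P i) (h.ne_bot i) (h.idempotent i)).map fracClass)) :
    Pi.mulSingle i g ∈ (h.localize hR hL).range := by
  obtain ⟨Z, Z', hgZ, hZZ, hZE, -⟩ := ConstituentGroup.exists_rep
    (isIdempotentElem_localIdeal (K := K) (P i) (h.ne_bot i) (h.idempotent i)) g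
  obtain ⟨a, X, Y, hXY, hXZ, hX1⟩ := exists_extendFrac_restrictFrac_eq hR hfc hD (h.maximal i)
    (h.ne_bot i) hZZ
  have hXYL : X * Y * extendFrac D L = extendFrac D L := by
    refine Subtype.ext ?_
    rw [Submonoid.coe_mul, hXY, h.coe_extendFrac, ← FractionalIdeal.coeIdeal_mul,
      ← Finset.mul_prod_erase Finset.univ _ (Finset.mem_univ i), ← mul_assoc, ← Ideal.map_mul,
      (h.idempotent i).eq]
  have hXYL' : restrictFrac D hD X * restrictFrac D hD Y * L = L := by
    have := congrArg (restrictFrac D hD) hXYL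
    rwa [restrictFrac_mul, restrictFrac_mul, h.restrictFrac_extendFrac] at this
  let x : ConstituentGroup (hL.map fracClass) := ConstituentGroup.mk _
    (fracClass (restrictFrac D hD X * L)) (fracClass (restrictFrac D hD Y * L))
    (by rw [← fracClass.map_mul, mul_assoc, hL.eq])
    (by rw [← fracClass.map_mul, mul_mul_mul_comm, hL.eq, hXYL'])
  have hx (j : Fin n) : (h.localize hR hL x j).1 =
      fracClass (extendFrac (localizationAt K (P j)) (restrictFrac D hD X) *
        localIdeal K (P j) (h.ne_bot j)) := by
    refine (h.coe_localize hR hL (X := restrictFrac D hD X * L) rfl j).trans ?_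
    rw [extendFrac_mul, h.extendFrac_localizationAt hR]
  have hxi : h.localize hR hL x i = g := by
    refine ConstituentGroup.ext ?_
    rw [hx, hgZ]
    refine fracClass_eq_iff.2 ⟨a, ?_⟩
    rw [← mul_assoc, hXZ, hZE]
  have hxj (j : Fin n) (hji : j ≠ i) : h.localize hR hL x j = 1 := by
    refine ConstituentGroup.ext ?_
    exact (hx j).trans (congrArg fracClass (mul_eq_of_eq_one
      (hX1 _ (h.maximal j) fun e => hji (h.map_injective hR e))))
  exact ⟨x, Pi.eq_mulSingle hxi hxj⟩

theorem IsPrimeProduct.localize_surjective (hR : HasSplitting R K)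
    (hfc : HasFiniteCharacter R) (h : IsPrimeProduct D hD P L) (hL : IsIdempotentElem L) :
    Function.Surjective (h.localize hR hL) := by
  intro g
  rw [← MonoidHom.mem_range, ← Finset.univ_prod_mulSingle g]
  exact prod_mem fun i _ => h.mulSingle_mem_range_localize hR hfc hL i (g i)

end

end

theorem corollary2p10 {R K : Type*} [CommRing R] [IsDomain R] [Field K] [Algebra R K]
    [IsFractionRing R K] (hR : IsPruferDomain R K) (hfc : HasFiniteCharacter R) :
    (∀ J : nonzeroFractionalIdeals R K,
      IsIdempotentElem (fracClass J) ↔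
        ∃ L : nonzeroFractionalIdeals R K,
          IsIdempotentElem L ∧ fracClass J = fracClass L ∧
          ((∃ (D : Subalgebra R K) (hD : IsFractionalOverring D),
              (L : FractionalIdeal R⁰ K) = overringIdeal D hD) ∨
            (∃ (D : Subalgebra R K) (hD : IsFractionalOverring D) (n : ℕ)
              (P : Fin n → PrimeSpectrum R), IsPrimeProduct D hD P L)) ∧
          ∀ L' : nonzeroFractionalIdeals R K,
            IsIdempotentElem L' → fracClass J = fracClass L' → L' = L) ∧
    (∀ (L : nonzeroFractionalIdeals R K) (hL : IsIdempotentElem L)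
      (D : Subalgebra R K) (hD : IsFractionalOverring D) (n : ℕ) (P : Fin n → PrimeSpectrum R)
      (h : IsPrimeProduct D hD P L),
      ∃ (φ : ClassGroup D →* ConstituentGroup (hL.map fracClass))
        (ψ : ConstituentGroup (hL.map fracClass) →*
          ∀ i, ConstituentGroup
            ((isIdempotentElem_localIdeal (K := K) (P i) (h.ne_bot i) (h.idempotent i)).map
              fracClass)),
        (∀ A : (FractionalIdeal D⁰ K)ˣ,
          (φ (ClassGroup.mk (K := K) A) : ClassSemigroup R K) =
            fracClass (restrictFrac D hD (ofUnit A) * L)) ∧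
        (∀ (g : ConstituentGroup (hL.map fracClass)) (X : nonzeroFractionalIdeals R K),
          (g : ClassSemigroup R K) = fracClass X →
          ∀ i, (ψ g i : ClassSemigroup (localizationAt K (P i)) K) =
            fracClass (extendFrac (localizationAt K (P i)) X)) ∧
        Function.Injective φ ∧ φ.range = ψ.ker ∧ Function.Surjective ψ) := by
  have hS := hR.hasSplitting
  refine ⟨fun J => ⟨fun hJ => ?_, ?_⟩, fun L hL D hD n P h => ?_⟩
  · obtain ⟨L, hL, hJL⟩ := exists_isIdempotentElem_of_fracClass hJ
    refine ⟨L, hL, hJL, eq_overringIdeal_or_isPrimeProduct hS hfc hL, fun L' hL' hJL' => ?_⟩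
    obtain ⟨x, rfl⟩ := fracClass_eq_iff.1 (hJL.symm.trans hJL')
    exact principalFrac_mul_eq_of_isIdempotentElem hL hL'
  · rintro ⟨L, hL, hJL, -⟩
    exact hJL ▸ hL.map fracClass
  · refine ⟨classGroupToConstituent hL h.mul_overringFrac, h.localize hS hL, fun A => ?_,
      fun g X hg i => h.coe_localize hS hL hg i, h.classGroupToConstituent_injective hS hL,
      le_antisymm (h.range_le_ker hS hL) (h.ker_le_range hS hfc hL),
      h.localize_surjective hS hfc hL⟩
    rw [classGroupToConstituent_mk]
    rfl
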